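/- All rings are associative with identity (not necessarily commutative) and modules are unitary left modules. For a ring $R$ and an $R$-module $C$, $\mathrm{Add}_R(C)$ denotes the class of $R$-modules isomorphic to direct summands of direct sums $C^{(I)}$ of copies of $C$. An exact sequence $\mathbf X$ of $R$-modules is called $\mathrm{Hom}_R(-,\mathrm{Add}_R(C))$-exact if $\mathrm{Hom}_R(\mathbf X,F)$ is exact for every $F\in \mathrm{Add}_R(C)$. The module $C$ is called w-tilting (weakly Wakamatsu tilting) if (1) $\mathrm{Ext}^i_R(C,C^{(I)})=0$ for every set $I$ and every $i\ge 1$, and (2) there is a $\mathrm{Hom}_R(-,\mathrm{Add}_R(C))$-exact exact sequence $0\to R\to A^0\to A^1\to\cdots$ of $R$-modules with $A^i\in\mathrm{Add}_R(C)$ for all $i\ge 0$. Let $A$ and $B$ be rings, $U$ a $(B,A)$-bimodule, and $T=\begin{pmatrix}A&0\\U&B\end{pmatrix}$ the triangular matrix ring. A triple $(M_1,M_2,\varphi)$ consisting of an $A$-module $M_1$, a $B$-module $M_2$ and a $B$-linear map $\varphi:U\otimes_A M_1\to M_2$ is regarded as the $T$-module of column vectors $\begin{pmatrix}m_1\\m_2\end{pmatrix}$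 with $\begin{pmatrix}a&0\\u&b\end{pmatrix}\begin{pmatrix}m_1\\m_2\end{pmatrix}=\begin{pmatrix}am_1\\ \varphi(u\otimes m_1)+bm_2\end{pmatrix}$. Let $C_1$ be an $A$-module and $C_2$ a $B$-module, and let $$C=\mathbf p(C_1,C_2)=\begin{pmatrix}C_1\\ (U\otimes_A C_1)\oplus C_2\end{pmatrix}$$ be the $T$-module whose structure map is the inclusion $U\otimes_A C_1\to (U\otimes_A C_1)\oplus C_2$. Assume that $U$ is $C$-compatible, that is: (a) the complex $U\otimes_A\mathbf X_1$ is exact for every exact sequence of $A$-modules $\mathbf X_1:\ \cdots\to P_1^1\to P_1^0\to C_1^0\to C_1^1\to\cdots$ with all $P_1^i$ projective and all $C_1^i\in\mathrm{Add}_A(C_1)$; and (b) the complex $\mathrm{Hom}_B(\mathbf X_2,U\otimes_A X_1)$ is exact for every $X_1\in\mathrm{Add}_A(C_1)$ and every $\mathrm{Hom}_B(-,\mathrm{Add}_B(C_2))$-exact exact sequence of $B$-modules $\mathbf X_2:\ \cdots\to P_2^1\to P_2^0\to C_2^0\to C_2^1\to\cdots$ with all $P_2^i$ projective and all $C_2^i\in\mathrm{Add}_B(C_2)$.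 Then $C$ is a w-tilting $T$-module if and only if $C_1$ is a w-tilting $A$-module and $C_2$ is a w-tilting $B$-module. -/

import Mathlib

open scoped TensorProduct RightActions

universe u

noncomputable section

/-! ### The triangular matrix ring -/

/-- The underlying set of the triangular matrix ring `(A 0; U B)`: the matrix `(a 0; x b)` has
the entries `a : A`, `x : U`, `b : B`. -/
@[ext]
structure TriRing (A B U : Type u) : Type u where
  a : A
  x : U
  b : B

namespace TriRing

section
variable {A B U : Type u} [Ring A] [Ring B] [AddCommGroup U]

instance : Zero (TriRing A B U) := ⟨⟨0, 0, 0⟩⟩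
instance : One (TriRing A B U) := ⟨⟨1, 0, 1⟩⟩
instance : Add (TriRing A B U) := ⟨fun s t => ⟨s.a + t.a, s.x + t.x, s.b + t.b⟩⟩
instance : Neg (TriRing A B U) := ⟨fun s => ⟨-s.a, -s.x, -s.b⟩⟩

@[simp] theorem zero_a : (0 : TriRing A B U).a = 0 := rfl
@[simp] theorem zero_x : (0 : TriRing A B U).x = 0 := rfl
@[simp] theorem zero_b : (0 : TriRing A B U).b = 0 := rfl
@[simp] theorem one_a : (1 : TriRing A B U).a = 1 := rfl
@[simp] theorem one_x : (1 : TriRing A B U).x = 0 := rfl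
@[simp] theorem one_b : (1 : TriRing A B U).b = 1 := rfl
@[simp] theorem add_a (s t : TriRing A B U) : (s + t).a = s.a + t.a := rfl
@[simp] theorem add_x (s t : TriRing A B U) : (s + t).x = s.x + t.x := rfl
@[simp] theorem add_b (s t : TriRing A B U) : (s + t).b = s.b + t.b := rfl
@[simp] theorem neg_a (s : TriRing A B U) : (-s).a = -s.a := rfl
@[simp] theorem neg_x (s : TriRing A B U) : (-s).x = -s.x := rfl
@[simp] theorem neg_b (s : TriRing A B U) : (-s).b = -s.b := rfl
end

section
variable {A B U : Type u} [Ring A] [Ring B] [AddCommGroup U] [Module B U] [Module Aᵐᵒᵖ U]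

/-- Matrix multiplication. -/
instance : Mul (TriRing A B U) :=
  ⟨fun s t => ⟨s.a * t.a, s.x <• t.a + s.b • t.x, s.b * t.b⟩⟩

@[simp] theorem mul_a (s t : TriRing A B U) : (s * t).a = s.a * t.a := rfl
@[simp] theorem mul_x (s t : TriRing A B U) : (s * t).x = s.x <• t.a + s.b • t.x := rfl
@[simp] theorem mul_b (s t : TriRing A B U) : (s * t).b = s.b * t.b := rfl

instance [SMulCommClass B Aᵐᵒᵖ U] : Ring (TriRing A B U) where
  add_assoc s t r := by ext <;> simp [add_assoc]
  zero_add s := by ext <;> simp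
  add_zero s := by ext <;> simp
  add_comm s t := by ext <;> simp [add_comm]
  neg_add_cancel s := by ext <;> simp
  nsmul := nsmulRec
  zsmul := zsmulRec
  zero_mul s := by ext <;> simp
  mul_zero s := by ext <;> simp
  one_mul s := by ext <;> simp
  mul_one s := by ext <;> simp
  left_distrib s t r := by
    ext
    · simp [mul_add]
    · simp [add_smul, smul_add]; abel
    · simp [mul_add]
  right_distrib s t r := by
    ext
    · simp [add_mul]
    · simp [add_smul, smul_add]; abel
    · simp [add_mul]
  mul_assoc s t r := by
    ext
    · simp [mul_assoc]
    · simp [mul_smul, smul_comm, add_assoc]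
    · simp [mul_assoc]

end

end TriRing

/-! ### The tensor product over a noncommutative ring -/

section Tensor

variable (A B U : Type u) [Ring A] [Ring B] [AddCommGroup U] [Module B U] [Module Aᵐᵒᵖ U]
variable (M N : Type u) [AddCommGroup M] [Module A M] [AddCommGroup N] [Module A N]

/-- The elements `u a ⊗ m - u ⊗ a m` of `U ⊗_ℤ M`. -/
def balancedRel : Set (U ⊗[ℤ] M) :=
  {z | ∃ (x : U) (a : A) (m : M), z = (x <• a) ⊗ₜ[ℤ] m - x ⊗ₜ[ℤ] (a • m)}

/-- The tensor product `U ⊗_A M` of a `(B, A)`-bimodule `U` and a left `A`-module `M`, as a left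
`B`-module: the quotient of `U ⊗_ℤ M` by the relations `u a ⊗ m = u ⊗ a m`. The set of relations
is stable under `B`, so that the `B`-submodule it spans is the additive subgroup it generates,
see `span_balancedRel`. -/
abbrev BTensor : Type u := (U ⊗[ℤ] M) ⧸ Submodule.span B (balancedRel A U M)

theorem span_balancedRel [SMulCommClass B Aᵐᵒᵖ U] :
    (Submodule.span B (balancedRel A U M)).toAddSubgroup =
      AddSubgroup.closure (balancedRel A U M) := by
  have key : ∀ (b : B) (z : U ⊗[ℤ] M), z ∈ AddSubgroup.closure (balancedRel A U M) →
      b • z ∈ AddSubgroup.closure (balancedRel A U M) := by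
    intro b z hz
    induction hz using AddSubgroup.closure_induction with
    | mem z h =>
      obtain ⟨x, a, m, rfl⟩ := h
      apply AddSubgroup.subset_closure
      refine ⟨b • x, a, m, ?_⟩
      rw [smul_sub, TensorProduct.smul_tmul', TensorProduct.smul_tmul', smul_comm]
    | zero => rw [smul_zero]; exact zero_mem _
    | add y z _ _ h1 h2 => rw [smul_add]; exact add_mem h1 h2
    | neg z _ h => rw [smul_neg]; exact neg_mem h
  apply le_antisymm
  · intro z hz
    exact Submodule.span_induction (p := fun z _ => z ∈ AddSubgroup.closure (balancedRel A U M))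
      (fun z h => AddSubgroup.subset_closure h) (zero_mem _)
      (fun y z _ _ h1 h2 => add_mem h1 h2) (fun b z _ h => key b z h) hz
  · rw [AddSubgroup.closure_le]
    exact fun z hz => Submodule.subset_span hz

variable {M} in
/-- The element `u ⊗ m` of `U ⊗_A M`. -/
def BTensor.tmul (x : U) (m : M) : BTensor A B U M :=
  Submodule.Quotient.mk (x ⊗ₜ[ℤ] m)

variable {A U M} in
theorem BTensor.smul_tmul (x : U) (a : A) (m : M) :
    BTensor.tmul A B U (x <• a) m = BTensor.tmul A B U x (a • m) :=
  (Submodule.Quotient.eq _).2 (Submodule.subset_span ⟨x, a, m, rfl⟩)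

variable {A B U M}

theorem BTensor.zero_tmul (m : M) : BTensor.tmul A B U 0 m = 0 := by
  simp [BTensor.tmul]

theorem BTensor.tmul_zero (x : U) : BTensor.tmul A B U x (0 : M) = 0 := by
  simp [BTensor.tmul]

theorem BTensor.add_tmul (x y : U) (m : M) :
    BTensor.tmul A B U (x + y) m = BTensor.tmul A B U x m + BTensor.tmul A B U y m := by
  simp [BTensor.tmul, TensorProduct.add_tmul]

theorem BTensor.tmul_add (x : U) (m n : M) :
    BTensor.tmul A B U x (m + n) = BTensor.tmul A B U x m + BTensor.tmul A B U x n := by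
  simp [BTensor.tmul, TensorProduct.tmul_add]

theorem BTensor.smul_tmul' (b : B) (x : U) (m : M) :
    BTensor.tmul A B U (b • x) m = b • BTensor.tmul A B U x m := rfl

variable {N} (B U)

/-- The map `1_U ⊗ f : U ⊗_A M → U ⊗_A N` induced by an `A`-linear map `f : M → N`. -/
def BTensor.map (f : M →ₗ[A] N) : BTensor A B U M →ₗ[B] BTensor A B U N :=
  Submodule.mapQ _ _
    (TensorProduct.AlgebraTensorModule.map (LinearMap.id : U →ₗ[B] U) (f.toAddMonoidHom.toIntLinearMap))
    (by
      rw [Submodule.span_le]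
      rintro _ ⟨x, a, m, rfl⟩
      refine Submodule.subset_span ⟨x, a, f m, ?_⟩
      simp)

@[simp] theorem BTensor.map_tmul (f : M →ₗ[A] N) (x : U) (m : M) :
    BTensor.map B U f (BTensor.tmul A B U x m) = BTensor.tmul A B U x (f m) := rfl

end Tensor

/-! ### Modules over the triangular matrix ring -/

section TriModule

variable {A B U : Type u} [Ring A] [Ring B] [AddCommGroup U] [Module B U] [Module Aᵐᵒᵖ U]
variable {M₁ M₂ : Type u} [AddCommGroup M₁] [Module A M₁] [AddCommGroup M₂] [Module B M₂]

/-- The left module over `(A 0; U B)` of a triple `(M₁, M₂, φ)` with `φ : U ⊗_A M₁ → M₂`: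
column vectors `(m₁; m₂)`, on which a matrix `(a 0; x b)` acts by
`(a m₁; φ (x ⊗ m₁) + b m₂)`. -/
@[nolint unusedArguments]
def TriModule (_φ : BTensor A B U M₁ →ₗ[B] M₂) : Type u := M₁ × M₂

namespace TriModule

variable (φ : BTensor A B U M₁ →ₗ[B] M₂)

instance : AddCommGroup (TriModule φ) := inferInstanceAs (AddCommGroup (M₁ × M₂))

instance : SMul (TriRing A B U) (TriModule φ) :=
  ⟨fun t m => ((t.a • m.1, φ (BTensor.tmul A B U t.x m.1) + t.b • m.2) : M₁ × M₂)⟩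

theorem smul_def (t : TriRing A B U) (m : TriModule φ) :
    t • m = ((t.a • m.1, φ (BTensor.tmul A B U t.x m.1) + t.b • m.2) : M₁ × M₂) := rfl

instance [SMulCommClass B Aᵐᵒᵖ U] : Module (TriRing A B U) (TriModule φ) where
  one_smul m := by
    refine Prod.ext (one_smul A m.1) ?_
    change φ (BTensor.tmul A B U 0 m.1) + (1 : B) • m.2 = m.2
    rw [BTensor.zero_tmul, map_zero, zero_add, one_smul]
  mul_smul s t m := by
    refine Prod.ext (mul_smul s.a t.a m.1) ?_
    change φ (BTensor.tmul A B U (s.x <• t.a + s.b • t.x) m.1) + (s.b * t.b) • m.2 =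
      φ (BTensor.tmul A B U s.x (t.a • m.1)) +
        s.b • (φ (BTensor.tmul A B U t.x m.1) + t.b • m.2)
    rw [BTensor.add_tmul, BTensor.smul_tmul, BTensor.smul_tmul', map_add, map_smul, smul_add,
      mul_smul, add_assoc]
  smul_zero t := by
    refine Prod.ext (smul_zero t.a) ?_
    change φ (BTensor.tmul A B U t.x 0) + t.b • (0 : M₂) = 0
    rw [BTensor.tmul_zero, map_zero, zero_add, smul_zero]
  smul_add t m n := by
    refine Prod.ext (smul_add t.a m.1 n.1) ?_
    change φ (BTensor.tmul A B U t.x (m.1 + n.1)) + t.b • (m.2 + n.2) =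
      (φ (BTensor.tmul A B U t.x m.1) + t.b • m.2) +
        (φ (BTensor.tmul A B U t.x n.1) + t.b • n.2)
    rw [BTensor.tmul_add, map_add, smul_add]
    abel
  add_smul s t m := by
    refine Prod.ext (add_smul s.a t.a m.1) ?_
    change φ (BTensor.tmul A B U (s.x + t.x) m.1) + (s.b + t.b) • m.2 =
      (φ (BTensor.tmul A B U s.x m.1) + s.b • m.2) +
        (φ (BTensor.tmul A B U t.x m.1) + t.b • m.2)
    rw [BTensor.add_tmul, map_add, add_smul]
    abel
  zero_smul m := by
    refine Prod.ext (zero_smul A m.1) ?_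
    change φ (BTensor.tmul A B U 0 m.1) + (0 : B) • m.2 = 0
    rw [BTensor.zero_tmul, map_zero, zero_add, zero_smul]

end TriModule

variable (A B U) in
/-- The module `p(M₁, M₂) = (M₁; (U ⊗_A M₁) ⊕ M₂)` over `(A 0; U B)`, whose structure map is the
inclusion of `U ⊗_A M₁`. -/
abbrev pModule (M₁ M₂ : Type u) [AddCommGroup M₁] [Module A M₁] [AddCommGroup M₂] [Module B M₂] :
    Type u :=
  TriModule (LinearMap.inl B (BTensor A B U M₁) M₂)

end TriModule

/-! ### w-tilting modules -/

/-- An exact sequence `⋯ → X (-1) → X 0 → X 1 → ⋯` of `R`-modules, exact at every place. -/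
structure ExactSeq (R : Type u) [Ring R] where
  X : ℤ → ModuleCat.{u} R
  d : ∀ n : ℤ, X n →ₗ[R] X (n + 1)
  exact : ∀ n : ℤ, Function.Exact (d n) (d (n + 1))

section WTilting

variable {R : Type u} [Ring R]

/-- `Hom_R(S, F)` is exact at every place. -/
def ExactSeq.HomExact (S : ExactSeq R) (F : Type u) [AddCommGroup F] [Module R F] : Prop :=
  ∀ n : ℤ, Function.Exact
    (fun g : S.X (n + 1 + 1) →ₗ[R] F => g ∘ₗ S.d (n + 1))
    (fun g : S.X (n + 1) →ₗ[R] F => g ∘ₗ S.d n)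

/-- `X` belongs to `Add_R(C)`: it is (isomorphic to) a direct summand of the direct sum `C^(I)` of
copies of `C`, for some set `I`. -/
def InAdd (C : Type u) [AddCommGroup C] [Module R C] (X : Type u) [AddCommGroup X] [Module R X] :
    Prop :=
  ∃ (I : Type u) (i : X →ₗ[R] (I →₀ C)) (r : (I →₀ C) →ₗ[R] X), r ∘ₗ i = LinearMap.id

/-- `S` is `Hom_R(-, Add_R(C))`-exact. -/
def ExactSeq.HomAddExact (S : ExactSeq R) (C : Type u) [AddCommGroup C] [Module R C] : Prop :=
  ∀ F : ModuleCat.{u} R, InAdd (R := R) C F → S.HomExact F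

variable (R) in
/-- Weakly Wakamatsu tilting (w-tilting) `R`-modules. The sequence `0 → R → A⁰ → A¹ → ⋯` is
written with `R` in degree `-1` and `Aⁿ` in degree `n`. -/
def IsWTilting (C : Type u) [AddCommGroup C] [Module R C] : Prop :=
  (∀ (I : Type u) (i : ℕ), 1 ≤ i →
    Subsingleton (CategoryTheory.Abelian.Ext (ModuleCat.of R C) (ModuleCat.of R (I →₀ C)) i)) ∧
  ∃ S : ExactSeq R,
    (∀ n : ℤ, n < -1 → Subsingleton (S.X n)) ∧
    Nonempty (S.X (-1) ≃ₗ[R] R) ∧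
    (∀ n : ℤ, 0 ≤ n → InAdd (R := R) C (S.X n)) ∧
    S.HomAddExact C

/-- `S` has the form `⋯ → P¹ → P⁰ → C⁰ → C¹ → ⋯` with the `Pⁱ` projective and the `Cⁱ` in
`Add_R(C)`; here `Cⁱ` is in degree `i` and `Pⁱ` in degree `-1 - i`. -/
def ExactSeq.IsProjAdd (S : ExactSeq R) (C : Type u) [AddCommGroup C] [Module R C] : Prop :=
  (∀ n : ℤ, n < 0 → Module.Projective R (S.X n)) ∧
  (∀ n : ℤ, 0 ≤ n → InAdd (R := R) C (S.X n))

end WTilting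

/-! ### Compatible bimodules -/

/-- The `(B, A)`-bimodule `U` is `C`-compatible, for `C = p(C₁, C₂)`. -/
def IsCompatible (A B U : Type u) [Ring A] [Ring B] [AddCommGroup U] [Module B U] [Module Aᵐᵒᵖ U]
    (C₁ C₂ : Type u) [AddCommGroup C₁] [Module A C₁] [AddCommGroup C₂] [Module B C₂] : Prop :=
  (∀ S : ExactSeq A, S.IsProjAdd C₁ →
    ∀ n : ℤ, Function.Exact (BTensor.map B U (S.d n)) (BTensor.map B U (S.d (n + 1)))) ∧
  (∀ S : ExactSeq B, S.IsProjAdd C₂ → S.HomAddExact C₂ →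
    ∀ X₁ : ModuleCat.{u} A, InAdd (R := A) C₁ X₁ → S.HomExact (BTensor A B U X₁))

end

/-! A `T`-linear map from `p(X₁, X₂)` to a triple `(N₁, N₂, ψ)` is the same as an arbitrary pair of
maps `X₁ → N₁`, `X₂ → N₂`, naturally in `X₁`, `X₂`. Moreover `p` commutes with direct sums. Hence,
when `U ⊗ S₁` is exact, `p(S₁, S₂)` is exact, and `Hom` into `p(C₁, C₂)^(I)` is exact on it if and
only if `Hom(S₁, C₁^(I))`, `Hom(S₂, U ⊗ C₁^(I))` and `Hom(S₂, C₂^(I))` are exact. Compatibility (a)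
supplies the exactness of `U ⊗ S₁`, and (b) deduces the middle condition from the last one for all
`I`. So `p(S₁, S₂)` is `Hom(-, Add)`-exact exactly when `S₁` and `S₂` are
(`ExactSeq.p_homAddExact_iff`).

Ext condition, both directions: vanishing of `Ext` is exactness of `Hom` on a projective resolution,
and `p` of two resolutions is a resolution of `p(C₁, C₂)` (`pModule_ext_vanishing_iff`).

Coresolution, from `C₁`, `C₂` to `C`: apply `p` to the two coresolutions, using `T ≅ p(A, B)`.

Coresolution, from `C` to `C₁`, `C₂`: the terms of the given sequence have split injective structure
maps, but its differentials need not come from `p`. The first components give the sequence for `C₁`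
and the cokernels of the structure maps the one for `C₂`; (a) makes the cokernels exact. Testing
against `(0, C₂^(I))` handles the cokernels (`cok_homExact`). Testing against `(C₁^(I), U ⊗ C₁^(I))`
handles the first components, after a correction by a map from the cokernels into `U ⊗ C₁^(I)` that
(b) provides (`fst_homExact`). -/

noncomputable section

/-! ### Vanishing of `Ext` through a projective resolution -/

section ExtVanishing

open CategoryTheory CategoryTheory.Abelian

variable {R : Type u} [Ring R]

/-- For a short exact sequence `0 → K → P → M → 0` with `P` projective, `Ext¹(M, N)` vanishes
if and only if every map `K → N` extends to `P`. -/
theorem subsingleton_ext_one_iff {K P M : Type u} (N : Type u) [AddCommGroup K] [Module R K]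
    [AddCommGroup P] [Module R P] [AddCommGroup M] [Module R M] [AddCommGroup N] [Module R N]
    [Module.Projective R P] (f : K →ₗ[R] P) (g : P →ₗ[R] M) (hf : Function.Injective f)
    (hg : Function.Surjective g) (hfg : Function.Exact f g) :
    Subsingleton (Ext (ModuleCat.of R M) (ModuleCat.of R N) 1) ↔
      ∀ h : K →ₗ[R] N, ∃ k : P →ₗ[R] N, k ∘ₗ f = h := by
  let S : ShortComplex (ModuleCat.{u} R) :=
    ShortComplex.mk (ModuleCat.ofHom f) (ModuleCat.ofHom g)
      (by ext x; exact hfg.apply_apply_eq_zero x)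
  have hS : S.ShortExact := ModuleCat.shortComplex_shortExact S hfg hf hg
  have : Projective S.X₂ := inferInstanceAs (Projective (ModuleCat.of R P))
  constructor
  · intro hE h
    -- The image of `h` under the connecting map lies in `Ext¹(M, N) = 0`, so `h` comes from `Hom(P,
    -- N)`.
    obtain ⟨k, hk⟩ := Ext.contravariant_sequence_exact₁ hS (ModuleCat.of R N)
      (Ext.mk₀ (ModuleCat.ofHom h)) (add_zero 1) (Subsingleton.elim (α := Ext (ModuleCat.of R M)
        (ModuleCat.of R N) 1) _ _)
    obtain ⟨k, rfl⟩ := (Ext.mk₀_bijective _ _).2 k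
    rw [Ext.mk₀_comp_mk₀] at hk
    have := (Ext.mk₀_bijective _ _).1 hk
    exact ⟨k.hom, congrArg ModuleCat.Hom.hom this⟩
  · intro hE
    refine subsingleton_of_forall_eq 0 fun x => ?_
    -- As `Ext¹(P, N) = 0`, every class is the extension class composed with some map `K → N`; if
    -- that map extends to `P`, the composite is zero.
    obtain ⟨y, hy⟩ := Ext.contravariant_sequence_exact₃ hS (ModuleCat.of R N) x
      (Ext.eq_zero_of_projective (n := 0) _) (add_zero 1)
    obtain ⟨h, rfl⟩ := (Ext.mk₀_bijective _ _).2 y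
    obtain ⟨k, hk⟩ := hE h.hom
    have : h = S.f ≫ ModuleCat.ofHom k := by
      ext x; exact (LinearMap.congr_fun hk x).symm
    rw [← hy, this, ← Ext.mk₀_comp_mk₀, ShortComplex.ShortExact.extClass_comp_assoc]

/-- For a short exact sequence `0 → K → P → M → 0` with `P` projective and `i ≥ 1`,
`Extⁱ⁺¹(M, N)` vanishes if and only if `Extⁱ(K, N)` does. -/
theorem subsingleton_ext_succ_iff {K P M : Type u} (N : Type u) [AddCommGroup K] [Module R K]
    [AddCommGroup P] [Module R P] [AddCommGroup M] [Module R M] [AddCommGroup N] [Module R N]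
    [Module.Projective R P] (f : K →ₗ[R] P) (g : P →ₗ[R] M) (hf : Function.Injective f)
    (hg : Function.Surjective g) (hfg : Function.Exact f g) (i : ℕ) :
    Subsingleton (Ext (ModuleCat.of R M) (ModuleCat.of R N) (i + 2)) ↔
      Subsingleton (Ext (ModuleCat.of R K) (ModuleCat.of R N) (i + 1)) := by
  let S : ShortComplex (ModuleCat.{u} R) :=
    ShortComplex.mk (ModuleCat.ofHom f) (ModuleCat.ofHom g)
      (by ext x; exact hfg.apply_apply_eq_zero x)
  have hS : S.ShortExact := ModuleCat.shortComplex_shortExact S hfg hf hg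
  have : Projective S.X₂ := inferInstanceAs (Projective (ModuleCat.of R P))
  constructor
  · intro hE
    refine subsingleton_of_forall_eq 0 fun x => ?_
    obtain ⟨y, hy⟩ := Ext.contravariant_sequence_exact₁ hS (ModuleCat.of R N) x
      (add_comm 1 (i + 1)) (Subsingleton.elim (α := Ext (ModuleCat.of R M)
        (ModuleCat.of R N) (i + 2)) _ _)
    rw [← hy, Ext.eq_zero_of_projective y, Ext.comp_zero]
  · intro hE
    refine subsingleton_of_forall_eq 0 fun x => ?_
    obtain ⟨y, hy⟩ := Ext.contravariant_sequence_exact₃ hS (ModuleCat.of R N) x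
      (Ext.eq_zero_of_projective (n := i + 1) _) (add_comm 1 (i + 1))
    rw [← hy, Subsingleton.elim (α := Ext (ModuleCat.of R K) (ModuleCat.of R N) (i + 1)) y 0,
      Ext.comp_zero]

/-- `Hom(S, N)` is exact if and only if all maps into `N` extend from the images of `S`. -/
theorem ExactSeq.homExact_iff_extend (S : ExactSeq R) (N : Type u) [AddCommGroup N]
    [Module R N] :
    S.HomExact N ↔ ∀ (n : ℤ) (h : LinearMap.range (S.d (n + 1)) →ₗ[R] N),
      ∃ k : S.X (n + 1 + 1) →ₗ[R] N, k ∘ₗ (LinearMap.range (S.d (n + 1))).subtype = h := by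
  refine forall_congr' fun n => ⟨fun H h => ?_, fun H g => ⟨fun hg => ?_, ?_⟩⟩
  · obtain ⟨k, hk⟩ := (H (h ∘ₗ (S.d (n + 1)).rangeRestrict)).1 (by
      ext x
      have : (S.d (n + 1)).rangeRestrict (S.d n x) = 0 :=
        Subtype.ext ((S.exact n).apply_apply_eq_zero x)
      simp [this])
    refine ⟨k, LinearMap.ext ?_⟩
    rintro ⟨_, x, rfl⟩
    exact LinearMap.congr_fun hk x
  · have hker : ∀ x, S.d (n + 1) x = 0 → g x = 0 := fun x hx => by
      obtain ⟨y, rfl⟩ := (S.exact n x).1 hx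
      exact LinearMap.congr_fun hg y
    have hle : LinearMap.ker (S.d (n + 1)) ≤ LinearMap.ker g := fun x hx => hker x hx
    obtain ⟨k, hk⟩ := H ((LinearMap.ker (S.d (n + 1))).liftQ g hle ∘ₗ
      (S.d (n + 1)).quotKerEquivRange.symm.toLinearMap)
    refine ⟨k, LinearMap.ext fun x => ?_⟩
    have h1 := LinearMap.congr_fun hk ((S.d (n + 1)).quotKerEquivRange (Submodule.Quotient.mk x))
    simpa using h1
  · rintro ⟨k, rfl⟩
    ext x
    simp [(S.exact n).apply_apply_eq_zero x]

/-- `S` is a projective resolution of `M`: it has the form `⋯ → P¹ → P⁰ → M → 0`, with `M` in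
degree `0`. -/
structure ExactSeq.IsResolution (S : ExactSeq R) (M : Type u) [AddCommGroup M] [Module R M] :
    Prop where
  projective : ∀ n : ℤ, n < 0 → Module.Projective R (S.X n)
  subsingleton : ∀ n : ℤ, 0 < n → Subsingleton (S.X n)
  equiv : Nonempty (S.X 0 ≃ₗ[R] M)

/-- Dimension shifting along the syzygies, which are the ranges of the differentials: `Ext^(i+1)` of
`M` becomes `Ext¹` of an iterated syzygy, whose vanishing says that maps into `N` extend from the
next syzygy to the projective containing it. All these extension properties together are exactness
of `Hom(S, N)`. -/
theorem ExactSeq.IsResolution.ext_iff {S : ExactSeq R} {M : Type u} [AddCommGroup M] [Module R M]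
    (hS : S.IsResolution M) (N : Type u) [AddCommGroup N] [Module R N] :
    (∀ i : ℕ, 1 ≤ i → Subsingleton (Ext (ModuleCat.of R M) (ModuleCat.of R N) i)) ↔
      S.HomExact N := by
  obtain ⟨e⟩ := hS.equiv
  let E : ℤ → Prop := fun n => ∀ h : LinearMap.range (S.d n) →ₗ[R] N,
    ∃ k : S.X (n + 1) →ₗ[R] N, k ∘ₗ (LinearMap.range (S.d n)).subtype = h
  let V : ℤ → ℕ → Prop := fun n i => Subsingleton
    (Ext (ModuleCat.of R (LinearMap.range (S.d n))) (ModuleCat.of R N) i)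
  have hsurj : Function.Surjective (S.d (-1)) := fun x =>
    ((S.exact (-1)) x).1 ((hS.subsingleton 1 one_pos).elim _ _)
  have exact_range : ∀ n, Function.Exact (LinearMap.range (S.d n)).subtype
      (S.d (n + 1)).rangeRestrict := fun n x => by
    rw [← (S.d (n+1)).rangeRestrict.mem_ker, LinearMap.ker_rangeRestrict, LinearMap.mem_ker,
      (S.exact n) x]
    simp
  have hproj : ∀ n : ℤ, n < -1 → Module.Projective R (S.X (n + 1)) := fun n hn =>
    hS.projective _ (by omega)
  have V1 : ∀ n, n < -1 → (V (n + 1) 1 ↔ E n) := fun n hn =>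
    have := hproj n hn
    subsingleton_ext_one_iff N _ _ (Submodule.subtype_injective _)
      (S.d (n + 1)).surjective_rangeRestrict (exact_range n)
  have V2 : ∀ n, n < -1 → ∀ i, (V (n + 1) (i + 2) ↔ V n (i + 1)) := fun n hn i =>
    have := hproj n hn
    subsingleton_ext_succ_iff N _ _ (Submodule.subtype_injective _)
      (S.d (n + 1)).surjective_rangeRestrict (exact_range n) i
  have := hS.projective (-1) (by norm_num)
  have hex : Function.Exact (LinearMap.range (S.d (-2))).subtype (e.toLinearMap ∘ₗ S.d (-1)) :=
    fun x => by
      change e (S.d (-1) x) = 0 ↔ _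
      rw [e.map_eq_zero_iff]
      exact ((S.exact (-2)) x).trans (by simp)
  have M1 : Subsingleton (Ext (ModuleCat.of R M) (ModuleCat.of R N) 1) ↔ E (-2) :=
    subsingleton_ext_one_iff N (P := S.X (-1)) (LinearMap.range (S.d (-2))).subtype
      (e.toLinearMap ∘ₗ S.d (-1)) (Submodule.subtype_injective _)
      (e.surjective.comp hsurj) hex
  have M2 : ∀ i, Subsingleton (Ext (ModuleCat.of R M) (ModuleCat.of R N) (i + 2)) ↔
      V (-2) (i + 1) :=
    subsingleton_ext_succ_iff N (P := S.X (-1)) (LinearMap.range (S.d (-2))).subtype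
      (e.toLinearMap ∘ₗ S.d (-1)) (Submodule.subtype_injective _)
      (e.surjective.comp hsurj) hex
  -- Only indices at most `-2` carry a condition: `d (-1)` is onto, and the terms in positive
  -- degrees vanish.
  have hE : S.HomExact N ↔ ∀ k : ℕ, E (-2 - k) := by
    rw [S.homExact_iff_extend]
    constructor
    · intro H k
      have := H (-2 - k - 1)
      rwa [sub_add_cancel] at this
    · intro H n
      obtain hn | rfl | hn := lt_trichotomy n (-2)
      · have := H (-3 - n).toNat
        rwa [show (-2 - ((-3 - n).toNat : ℤ)) = n + 1 by omega] at this
      · intro h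
        refine ⟨h ∘ₗ (LinearEquiv.ofTop _ (LinearMap.range_eq_top.2 hsurj)).symm.toLinearMap, ?_⟩
        ext x
        rfl
      · have := hS.subsingleton (n + 1 + 1) (by omega)
        exact fun h => ⟨0, LinearMap.ext fun x => by
          rw [Subsingleton.elim x 0, map_zero, map_zero]⟩
  have step : ∀ k : ℕ, (-2 - ((k + 1 : ℕ) : ℤ)) + 1 = -2 - k := fun k => by push_cast; ring
  rw [hE]
  constructor
  · intro H
    -- Induction on the depth `k` of the syzygy, for all Ext degrees at once: one step deeper uses
    -- up one Ext degree.
    have hV : ∀ k i : ℕ, V (-2 - k) (i + 1) := fun k => by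
      induction k with
      | zero => exact fun i => by simpa using (M2 i).1 (H _ (by omega))
      | succ k ih =>
        intro i
        rw [← V2 _ (by omega), step]
        exact ih _
    rintro (_ | k)
    · simpa using M1.1 (H 1 le_rfl)
    · rw [← V1 _ (by omega), step]
      exact hV k 0
  · intro H
    -- Here the induction is on the Ext degree, for all depths at once: the degree drops by one on
    -- passing to the next syzygy.
    have hV : ∀ i k : ℕ, V (-2 - k) (i + 1) := fun i => by
      induction i with
      | zero => exact fun k => by rw [← step, V1 _ (by omega)]; exact H _
      | succ i ih =>
        intro k
        rw [← step, V2 _ (by omega)]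
        exact ih _
    rintro (_ | _ | i) hi
    · omega
    · exact M1.2 (by simpa using H 0)
    · exact (M2 i).2 (by simpa using hV i 0)

/-- The iterated syzygies of a module, with respect to the tautological free covers. -/
def freeSyzygy (R : Type u) [Ring R] (M : ModuleCat.{u} R) : ℕ → ModuleCat.{u} R
  | 0 => M
  | k + 1 => ModuleCat.of R (LinearMap.ker
      (Finsupp.linearCombination R (id : freeSyzygy R M k → freeSyzygy R M k)))

/-- The modules of the tautological free resolution. -/
def freeResolutionX (R : Type u) [Ring R] (M : ModuleCat.{u} R) : ℤ → ModuleCat.{u} R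
  | .ofNat 0 => M
  | .ofNat (_ + 1) => ModuleCat.of R PUnit
  | .negSucc k => ModuleCat.of R (freeSyzygy R M k →₀ R)

/-- The differentials of the tautological free resolution. -/
def freeResolutionD (R : Type u) [Ring R] (M : ModuleCat.{u} R) :
    ∀ n : ℤ, freeResolutionX R M n →ₗ[R] freeResolutionX R M (n + 1)
  | .ofNat _ => 0
  | .negSucc 0 => Finsupp.linearCombination R (id : M → M)
  | .negSucc (k + 1) => (LinearMap.ker
      (Finsupp.linearCombination R (id : freeSyzygy R M k → freeSyzygy R M k))).subtype ∘ₗ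
      Finsupp.linearCombination R (id : freeSyzygy R M (k + 1) → freeSyzygy R M (k + 1))

theorem freeResolution_exact (R : Type u) [Ring R] (M : ModuleCat.{u} R) :
    ∀ n : ℤ, Function.Exact (freeResolutionD R M n) (freeResolutionD R M (n + 1))
  | .ofNat n => fun x => ⟨fun _ => ⟨0, Subsingleton.elim (α := PUnit) _ _⟩, fun _ => rfl⟩
  | .negSucc 0 => fun x => ⟨fun _ => Finsupp.linearCombination_id_surjective R M x, fun _ => rfl⟩
  -- The map out of degree `-1` is the cover itself, not followed by the inclusion of a syzygy, so
  -- this place is separate from the deeper ones.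
  | .negSucc 1 => fun x => by
    constructor
    · intro hx
      obtain ⟨y, hy⟩ := Finsupp.linearCombination_id_surjective R (freeSyzygy R M 1) ⟨x, hx⟩
      exact ⟨y, congrArg Subtype.val hy⟩
    · rintro ⟨y, rfl⟩
      exact (Finsupp.linearCombination R (id : freeSyzygy R M 1 → freeSyzygy R M 1) y).2
  | .negSucc (k + 2) => fun x => by
    constructor
    · intro hx
      obtain ⟨y, hy⟩ := Finsupp.linearCombination_id_surjective R (freeSyzygy R M (k + 2))
        ⟨x, Subtype.ext hx⟩
      exact ⟨y, congrArg Subtype.val hy⟩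
    · rintro ⟨y, rfl⟩
      exact congrArg Subtype.val
        (Finsupp.linearCombination R (id : freeSyzygy R M (k + 2) → freeSyzygy R M (k + 2)) y).2

theorem exists_isResolution (M : Type u) [AddCommGroup M] [Module R M] :
    ∃ S : ExactSeq R, S.IsResolution M := by
  refine ⟨⟨_, _, freeResolution_exact R (ModuleCat.of R M)⟩, ?_, ?_, ⟨LinearEquiv.refl R M⟩⟩
  · rintro (n | n) hn
    · exact absurd hn (Int.natCast_nonneg n).not_gt
    · exact inferInstanceAs (Module.Projective R (_ →₀ R))
  · rintro ((_ | n) | n) hn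
    · exact absurd hn (by simp)
    · exact inferInstanceAs (Subsingleton PUnit)
    · exact absurd hn (by simp)

end ExtVanishing

/-! ### The tensor product: lifting and functoriality -/

namespace BTensor

variable {A B U : Type u} [Ring A] [Ring B] [AddCommGroup U] [Module B U] [Module Aᵐᵒᵖ U]
variable {M N P : Type u} [AddCommGroup M] [Module A M] [AddCommGroup N] [Module A N]
  [AddCommGroup P] [Module A P]
variable {Q : Type u} [AddCommGroup Q] [Module B Q]

@[elab_as_elim]
theorem induction_on {p : BTensor A B U M → Prop} (z : BTensor A B U M)
    (tmul : ∀ x m, p (tmul A B U x m)) (add : ∀ y z, p y → p z → p (y + z)) : p z := by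
  obtain ⟨z, rfl⟩ := Submodule.Quotient.mk_surjective _ z
  induction z using TensorProduct.induction_on with
  | zero => simpa [BTensor.zero_tmul] using tmul 0 0
  | tmul x m => exact tmul x m
  | add y z hy hz => exact add _ _ hy hz

theorem hom_ext {f g : BTensor A B U M →ₗ[B] Q}
    (h : ∀ x m, f (tmul A B U x m) = g (tmul A B U x m)) : f = g := by
  refine LinearMap.ext fun z => ?_
  induction z using BTensor.induction_on with
  | tmul x m => exact h x m
  | add y z hy hz => rw [map_add, map_add, hy, hz]

/-- The linear map on `U ⊗_A M` induced by a balanced biadditive map. -/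
def lift (f : U →+ M →+ Q) (hB : ∀ (b : B) x m, f (b • x) m = b • f x m)
    (hA : ∀ (x : U) (a : A) m, f (x <• a) m = f x (a • m)) : BTensor A B U M →ₗ[B] Q :=
  Submodule.liftQ _
    { TensorProduct.liftAddHom (R := ℤ) f (fun r x m => by simp) with
      map_smul' := fun b z => by
        change TensorProduct.liftAddHom (R := ℤ) f _ (b • z) =
          b • TensorProduct.liftAddHom (R := ℤ) f _ z
        induction z using TensorProduct.induction_on with
        | zero => simp
        | tmul x m => exact hB b x m
        | add y z hy hz => rw [smul_add, map_add, map_add, smul_add, hy, hz] }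
    (by
      rw [Submodule.span_le]
      rintro _ ⟨x, a, m, rfl⟩
      rw [SetLike.mem_coe, LinearMap.mem_ker, map_sub, sub_eq_zero]
      exact hA x a m)

@[simp] theorem map_id : map B U (LinearMap.id : M →ₗ[A] M) = LinearMap.id :=
  hom_ext fun _ _ => rfl

theorem map_comp (g : N →ₗ[A] P) (f : M →ₗ[A] N) : map B U (g ∘ₗ f) = map B U g ∘ₗ map B U f :=
  hom_ext fun _ _ => rfl

theorem map_map (g : N →ₗ[A] P) (f : M →ₗ[A] N) (z : BTensor A B U M) :
    map B U g (map B U f z) = map B U (g ∘ₗ f) z := by rw [map_comp]; rfl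

@[simp] theorem map_zero : map B U (0 : M →ₗ[A] N) = 0 :=
  hom_ext fun x _ => BTensor.tmul_zero x

theorem subsingleton [Subsingleton M] : Subsingleton (BTensor A B U M) :=
  subsingleton_of_forall_eq 0 fun z => by
    induction z using BTensor.induction_on with
    | tmul x m => rw [Subsingleton.elim m 0, BTensor.tmul_zero]
    | add y z hy hz => rw [hy, hz, add_zero]

end BTensor

/-! ### Linear maps between modules over the triangular matrix ring -/

namespace TriModule

section

variable {A B U : Type u} [Ring A] [Ring B] [AddCommGroup U] [Module B U] [Module Aᵐᵒᵖ U]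
variable {M₁ M₂ N₁ N₂ P₁ P₂ : Type u} [AddCommGroup M₁] [Module A M₁] [AddCommGroup M₂]
  [Module B M₂] [AddCommGroup N₁] [Module A N₁] [AddCommGroup N₂] [Module B N₂]
  [AddCommGroup P₁] [Module A P₁] [AddCommGroup P₂] [Module B P₂]
variable {φ : BTensor A B U M₁ →ₗ[B] M₂} {ψ : BTensor A B U N₁ →ₗ[B] N₂}
  {χ : BTensor A B U P₁ →ₗ[B] P₂}

variable (φ) in
/-- The column vector `(m₁; m₂)`. -/
def mk (m₁ : M₁) (m₂ : M₂) : TriModule φ := (m₁, m₂)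

@[simp] theorem mk_fst (m₁ : M₁) (m₂ : M₂) : (mk φ m₁ m₂).1 = m₁ := rfl
@[simp] theorem mk_snd (m₁ : M₁) (m₂ : M₂) : (mk φ m₁ m₂).2 = m₂ := rfl
@[simp] theorem fst_add (m n : TriModule φ) : (m + n).1 = m.1 + n.1 := rfl
@[simp] theorem snd_add (m n : TriModule φ) : (m + n).2 = m.2 + n.2 := rfl
@[simp] theorem fst_zero : (0 : TriModule φ).1 = 0 := rfl
@[simp] theorem snd_zero : (0 : TriModule φ).2 = 0 := rfl
theorem fst_smul (t : TriRing A B U) (m : TriModule φ) : (t • m).1 = t.a • m.1 := rfl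
theorem snd_smul (t : TriRing A B U) (m : TriModule φ) :
    (t • m).2 = φ (BTensor.tmul A B U t.x m.1) + t.b • m.2 := rfl

theorem ext' {m n : TriModule φ} (h₁ : m.1 = n.1) (h₂ : m.2 = n.2) : m = n := Prod.ext h₁ h₂

theorem mk_add (m₁ n₁ : M₁) (m₂ n₂ : M₂) :
    mk φ (m₁ + n₁) (m₂ + n₂) = mk φ m₁ m₂ + mk φ n₁ n₂ := rfl

variable [SMulCommClass B Aᵐᵒᵖ U]

/-- The linear map `(M₁, M₂, φ) → (N₁, N₂, ψ)` with given components. -/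
def map (f₁ : M₁ →ₗ[A] N₁) (f₂ : M₂ →ₗ[B] N₂) (h : ∀ z, f₂ (φ z) = ψ (BTensor.map B U f₁ z)) :
    TriModule φ →ₗ[TriRing A B U] TriModule ψ where
  toFun m := mk ψ (f₁ m.1) (f₂ m.2)
  map_add' m n := ext' (map_add f₁ _ _) (map_add f₂ _ _)
  map_smul' t m := ext' (map_smul f₁ _ _) (by
    rw [mk_snd, snd_smul, map_add, map_smul, h]; rfl)

@[simp] theorem map_fst (f₁ : M₁ →ₗ[A] N₁) (f₂ : M₂ →ₗ[B] N₂)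
    (h : ∀ z, f₂ (φ z) = ψ (BTensor.map B U f₁ z)) (m : TriModule φ) :
    (map f₁ f₂ h m).1 = f₁ m.1 := rfl

@[simp] theorem map_snd (f₁ : M₁ →ₗ[A] N₁) (f₂ : M₂ →ₗ[B] N₂)
    (h : ∀ z, f₂ (φ z) = ψ (BTensor.map B U f₁ z)) (m : TriModule φ) :
    (map f₁ f₂ h m).2 = f₂ m.2 := rfl

/-- The diagonal idempotent `(1, 0)` fixes `(m; 0)` and kills the second component of every vector,
so linear maps respect the decomposition into components. -/
theorem apply_mk_zero_snd (f : TriModule φ →ₗ[TriRing A B U] TriModule ψ) (m : M₁) :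
    (f (mk φ m 0)).2 = 0 := by
  have h : (⟨1, 0, 0⟩ : TriRing A B U) • mk φ m 0 = mk φ m 0 :=
    ext' (one_smul A m) (by simp [snd_smul, BTensor.zero_tmul])
  rw [← h, map_smul, snd_smul]
  simp [BTensor.zero_tmul]

theorem apply_mk_zero_fst (f : TriModule φ →ₗ[TriRing A B U] TriModule ψ) (m : M₂) :
    (f (mk φ 0 m)).1 = 0 := by
  have h : (⟨0, 0, 1⟩ : TriRing A B U) • mk φ 0 m = mk φ 0 m :=
    ext' (by simp [fst_smul]) (by simp [snd_smul, BTensor.zero_tmul])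
  rw [← h, map_smul, fst_smul]
  simp

/-- The first component of a linear map. -/
def fstMap (f : TriModule φ →ₗ[TriRing A B U] TriModule ψ) : M₁ →ₗ[A] N₁ where
  toFun m := (f (mk φ m 0)).1
  map_add' m n := by
    rw [← fst_add, ← map_add, ← mk_add, add_zero]
  map_smul' a m := by
    have h : (⟨a, 0, 0⟩ : TriRing A B U) • mk φ m 0 = mk φ (a • m) 0 :=
      ext' rfl (by simp [snd_smul, BTensor.zero_tmul])
    rw [← h, map_smul]
    rfl

/-- The second component of a linear map. -/
def sndMap (f : TriModule φ →ₗ[TriRing A B U] TriModule ψ) : M₂ →ₗ[B] N₂ where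
  toFun m := (f (mk φ 0 m)).2
  map_add' m n := by
    rw [← snd_add, ← map_add, ← mk_add, add_zero]
  map_smul' b m := by
    have h : (⟨0, 0, b⟩ : TriRing A B U) • mk φ 0 m = mk φ 0 (b • m) :=
      ext' (by simp [fst_smul]) (by simp [snd_smul, BTensor.zero_tmul])
    rw [← h, map_smul, snd_smul]
    simp [BTensor.zero_tmul]

theorem apply_eq (f : TriModule φ →ₗ[TriRing A B U] TriModule ψ) (m : TriModule φ) :
    f m = mk ψ (fstMap f m.1) (sndMap f m.2) := by
  have h : m = mk φ m.1 0 + mk φ 0 m.2 := ext' (by simp) (by simp)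
  conv_lhs => rw [h, map_add]
  refine ext' ?_ ?_
  · rw [fst_add, apply_mk_zero_fst, add_zero]; rfl
  · rw [snd_add, apply_mk_zero_snd, zero_add]; rfl

theorem apply_fst (f : TriModule φ →ₗ[TriRing A B U] TriModule ψ) (m : TriModule φ) :
    (f m).1 = fstMap f m.1 := by rw [apply_eq]; rfl

theorem apply_snd (f : TriModule φ →ₗ[TriRing A B U] TriModule ψ) (m : TriModule φ) :
    (f m).2 = sndMap f m.2 := by rw [apply_eq]; rfl

/-- The strictly lower triangular matrix with entry `x` sends `(m; 0)` to `(0; φ (x ⊗ m))`;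
linearity over such matrices is compatibility with the structure maps. -/
theorem sndMap_apply_structure (f : TriModule φ →ₗ[TriRing A B U] TriModule ψ)
    (z : BTensor A B U M₁) : sndMap f (φ z) = ψ (BTensor.map B U (fstMap f) z) := by
  induction z using BTensor.induction_on with
  | tmul x m =>
    have h : (⟨0, x, 0⟩ : TriRing A B U) • mk φ m 0 = mk φ 0 (φ (BTensor.tmul A B U x m)) :=
      ext' (by simp [fst_smul]) (by simp [snd_smul])
    change (f (mk φ 0 _)).2 = _
    rw [← h, map_smul, snd_smul, zero_smul, add_zero]
    rfl
  | add y z hy hz => simp only [map_add, hy, hz]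

@[simp] theorem fstMap_map (f₁ : M₁ →ₗ[A] N₁) (f₂ : M₂ →ₗ[B] N₂)
    (h : ∀ z, f₂ (φ z) = ψ (BTensor.map B U f₁ z)) : fstMap (map f₁ f₂ h) = f₁ := rfl

@[simp] theorem sndMap_map (f₁ : M₁ →ₗ[A] N₁) (f₂ : M₂ →ₗ[B] N₂)
    (h : ∀ z, f₂ (φ z) = ψ (BTensor.map B U f₁ z)) : sndMap (map f₁ f₂ h) = f₂ := rfl

@[simp] theorem fstMap_id : fstMap (LinearMap.id : TriModule φ →ₗ[TriRing A B U] _) =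
    LinearMap.id := rfl

theorem fstMap_comp (g : TriModule ψ →ₗ[TriRing A B U] TriModule χ)
    (f : TriModule φ →ₗ[TriRing A B U] TriModule ψ) :
    fstMap (g ∘ₗ f) = fstMap g ∘ₗ fstMap f :=
  LinearMap.ext fun _ => apply_fst g _

theorem sndMap_comp (g : TriModule ψ →ₗ[TriRing A B U] TriModule χ)
    (f : TriModule φ →ₗ[TriRing A B U] TriModule ψ) :
    sndMap (g ∘ₗ f) = sndMap g ∘ₗ sndMap f :=
  LinearMap.ext fun _ => apply_snd g _

theorem hom_ext {f g : TriModule φ →ₗ[TriRing A B U] TriModule ψ} (h₁ : fstMap f = fstMap g)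
    (h₂ : sndMap f = sndMap g) : f = g :=
  LinearMap.ext fun m => by rw [apply_eq, apply_eq g, h₁, h₂]

theorem sndMap_zero : sndMap (0 : TriModule φ →ₗ[TriRing A B U] TriModule ψ) = 0 := rfl

/-- The map induced on the cokernels of the structure maps. -/
def cokMap (f : TriModule φ →ₗ[TriRing A B U] TriModule ψ) :
    (M₂ ⧸ LinearMap.range φ) →ₗ[B] (N₂ ⧸ LinearMap.range ψ) :=
  Submodule.mapQ _ _ (sndMap f) (by
    rintro _ ⟨z, rfl⟩
    exact ⟨_, (sndMap_apply_structure f z).symm⟩)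

@[simp] theorem cokMap_mk (f : TriModule φ →ₗ[TriRing A B U] TriModule ψ) (m : M₂) :
    cokMap f (Submodule.Quotient.mk m) = Submodule.Quotient.mk (sndMap f m) := rfl

theorem cokMap_id : cokMap (LinearMap.id : TriModule φ →ₗ[TriRing A B U] _) = LinearMap.id := by
  ext; rfl

theorem cokMap_comp (g : TriModule ψ →ₗ[TriRing A B U] TriModule χ)
    (f : TriModule φ →ₗ[TriRing A B U] TriModule ψ) :
    cokMap (g ∘ₗ f) = cokMap g ∘ₗ cokMap f := by
  apply Submodule.linearMap_qext
  ext m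
  simp [sndMap_comp]

/-- Isomorphic modules have isomorphic first components. -/
def fstEquiv (e : TriModule φ ≃ₗ[TriRing A B U] TriModule ψ) : M₁ ≃ₗ[A] N₁ :=
  LinearEquiv.ofLinearMap (fstMap e.toLinearMap) (fstMap e.symm.toLinearMap)
    (by rw [← fstMap_comp, LinearEquiv.comp_symm, fstMap_id])
    (by rw [← fstMap_comp, LinearEquiv.symm_comp, fstMap_id])

/-- Isomorphic modules have structure maps with isomorphic cokernels. -/
def cokEquiv (e : TriModule φ ≃ₗ[TriRing A B U] TriModule ψ) :
    (M₂ ⧸ LinearMap.range φ) ≃ₗ[B] (N₂ ⧸ LinearMap.range ψ) :=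
  LinearEquiv.ofLinearMap (cokMap e.toLinearMap) (cokMap e.symm.toLinearMap)
    (by rw [← cokMap_comp, LinearEquiv.comp_symm, cokMap_id])
    (by rw [← cokMap_comp, LinearEquiv.symm_comp, cokMap_id])

end

/-! Every module over the triangular matrix ring is given by a triple. -/

section Components

variable {A B U : Type u} [Ring A] [Ring B] [AddCommGroup U] [Module B U] [Module Aᵐᵒᵖ U]
  [SMulCommClass B Aᵐᵒᵖ U]
variable (A B U) (M : Type u) [AddCommGroup M] [Module (TriRing A B U) M]

/-- The first component of a module over the triangular matrix ring. -/
def Fst : AddSubgroup M where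
  carrier := {m | (⟨1, 0, 0⟩ : TriRing A B U) • m = m}
  zero_mem' := smul_zero _
  add_mem' {m n} hm hn := by
    change _ • (m + n) = m + n
    rw [smul_add, hm, hn]
  neg_mem' {m} hm := by
    change _ • (-m) = -m
    rw [smul_neg, hm]

/-- The second component of a module over the triangular matrix ring. -/
def Snd : AddSubgroup M where
  carrier := {m | (⟨0, 0, 1⟩ : TriRing A B U) • m = m}
  zero_mem' := smul_zero _
  add_mem' {m n} hm hn := by
    change _ • (m + n) = m + n
    rw [smul_add, hm, hn]
  neg_mem' {m} hm := by
    change _ • (-m) = -m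
    rw [smul_neg, hm]

variable {M}

theorem smul_mem_fst (a : A) (m : M) : (⟨a, 0, 0⟩ : TriRing A B U) • m ∈ Fst A B U M := by
  change (⟨1, 0, 0⟩ : TriRing A B U) • _ = _
  rw [smul_smul]
  congr 1
  ext <;> simp

theorem smul_mem_snd (b : B) (m : M) : (⟨0, 0, b⟩ : TriRing A B U) • m ∈ Snd A B U M := by
  change (⟨0, 0, 1⟩ : TriRing A B U) • _ = _
  rw [smul_smul]
  congr 1
  ext <;> simp

theorem offDiag_smul_mem_snd (x : U) (m : M) :
    (⟨0, x, 0⟩ : TriRing A B U) • m ∈ Snd A B U M := by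
  change (⟨0, 0, 1⟩ : TriRing A B U) • _ = _
  rw [smul_smul]
  congr 1
  ext <;> simp

instance : Module A (Fst A B U M) where
  smul a m := ⟨(⟨a, 0, 0⟩ : TriRing A B U) • (m : M), smul_mem_fst A B U a _⟩
  one_smul m := Subtype.ext m.2
  mul_smul a a' m := Subtype.ext (by
    change (⟨a * a', 0, 0⟩ : TriRing A B U) • (m : M) = _ • (_ • (m : M))
    rw [smul_smul]
    congr 1
    ext <;> simp)
  smul_zero a := Subtype.ext (smul_zero _)
  smul_add a m n := Subtype.ext (smul_add _ _ _)
  add_smul a a' m := Subtype.ext (by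
    change (⟨a + a', 0, 0⟩ : TriRing A B U) • (m : M) = _ • (m : M) + _ • (m : M)
    rw [← add_smul]
    congr 1
    ext <;> simp)
  zero_smul m := Subtype.ext (zero_smul (TriRing A B U) (m : M))

instance : Module B (Snd A B U M) where
  smul b m := ⟨(⟨0, 0, b⟩ : TriRing A B U) • (m : M), smul_mem_snd A B U b _⟩
  one_smul m := Subtype.ext m.2
  mul_smul a a' m := Subtype.ext (by
    change (⟨0, 0, a * a'⟩ : TriRing A B U) • (m : M) = _ • (_ • (m : M))
    rw [smul_smul]
    congr 1
    ext <;> simp)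
  smul_zero a := Subtype.ext (smul_zero _)
  smul_add a m n := Subtype.ext (smul_add _ _ _)
  add_smul a a' m := Subtype.ext (by
    change (⟨0, 0, a + a'⟩ : TriRing A B U) • (m : M) = _ • (m : M) + _ • (m : M)
    rw [← add_smul]
    congr 1
    ext <;> simp)
  zero_smul m := Subtype.ext (zero_smul (TriRing A B U) (m : M))

theorem coe_fst_smul (a : A) (m : Fst A B U M) :
    ((a • m : Fst A B U M) : M) = (⟨a, 0, 0⟩ : TriRing A B U) • (m : M) := rfl

theorem coe_snd_smul (b : B) (m : Snd A B U M) :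
    ((b • m : Snd A B U M) : M) = (⟨0, 0, b⟩ : TriRing A B U) • (m : M) := rfl

variable (M) in
/-- The structure map of a module over the triangular matrix ring. -/
def structureMap : BTensor A B U (Fst A B U M) →ₗ[B] Snd A B U M :=
  BTensor.lift
    (AddMonoidHom.mk' (fun x => AddMonoidHom.mk'
      (fun m => ⟨(⟨0, x, 0⟩ : TriRing A B U) • (m : M), offDiag_smul_mem_snd A B U x _⟩)
      (fun m n => Subtype.ext (smul_add _ _ _)))
      (fun x y => by
        ext m
        change (⟨0, x + y, 0⟩ : TriRing A B U) • (m : M) = _ • (m : M) + _ • (m : M)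
        rw [← add_smul]
        congr 1
        ext <;> simp))
    (fun b x m => Subtype.ext (by
      change (⟨0, b • x, 0⟩ : TriRing A B U) • (m : M) = (⟨0, 0, b⟩ : TriRing A B U) •
        (⟨0, x, 0⟩ : TriRing A B U) • (m : M)
      rw [smul_smul]
      congr 1
      ext <;> simp))
    (fun x a m => Subtype.ext (by
      change (⟨0, x <• a, 0⟩ : TriRing A B U) • (m : M) = (⟨0, x, 0⟩ : TriRing A B U) •
        (⟨a, 0, 0⟩ : TriRing A B U) • (m : M)
      rw [smul_smul]
      congr 1
      ext <;> simp))

theorem coe_structureMap_tmul (x : U) (m : Fst A B U M) :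
    (structureMap A B U M (BTensor.tmul A B U x m) : M) = (⟨0, x, 0⟩ : TriRing A B U) • (m : M) :=
  rfl

variable (M) in
/-- A module over the triangular matrix ring is the module of the triple of its components. -/
def equivComponents : TriModule (structureMap A B U M) ≃ₗ[TriRing A B U] M where
  toFun m := (m.1 : M) + (m.2 : M)
  map_add' m n := by
    simp only [fst_add, snd_add, AddSubgroup.coe_add]; abel
  map_smul' t m := by
    have h₁ : (⟨1, 0, 0⟩ : TriRing A B U) • (m.1 : M) = m.1 := m.1.2
    have h₂ : (⟨0, 0, 1⟩ : TriRing A B U) • (m.2 : M) = m.2 := m.2.2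
    rw [fst_smul, snd_smul, AddSubgroup.coe_add, coe_fst_smul, coe_snd_smul,
      coe_structureMap_tmul, ← add_assoc, ← add_smul, RingHom.id_apply, smul_add]
    congr 1
    · rw [← h₁, smul_smul, smul_smul]
      congr 1
      ext <;> simp
    · rw [← h₂, smul_smul, smul_smul]
      congr 1
      ext <;> simp
  invFun m := mk _ ⟨_, smul_mem_fst A B U 1 m⟩ ⟨_, smul_mem_snd A B U 1 m⟩
  left_inv m := by
    have h₁ : (⟨1, 0, 0⟩ : TriRing A B U) • (m.1 : M) = m.1 := m.1.2
    have h₂ : (⟨0, 0, 1⟩ : TriRing A B U) • (m.2 : M) = m.2 := m.2.2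
    refine ext' (Subtype.ext ?_) (Subtype.ext ?_)
    · change (⟨1, 0, 0⟩ : TriRing A B U) • ((m.1 : M) + (m.2 : M)) = m.1
      rw [smul_add, h₁, ← h₂, smul_smul, add_eq_left]
      convert zero_smul (TriRing A B U) (m.2 : M) using 2
      ext <;> simp
    · change (⟨0, 0, 1⟩ : TriRing A B U) • ((m.1 : M) + (m.2 : M)) = m.2
      rw [smul_add, h₂, ← h₁, smul_smul, add_eq_right]
      convert zero_smul (TriRing A B U) (m.1 : M) using 2
      ext <;> simp
  right_inv m := by
    change (⟨1, 0, 0⟩ : TriRing A B U) • m + (⟨0, 0, 1⟩ : TriRing A B U) • m = m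
    rw [← add_smul]
    convert one_smul (TriRing A B U) m using 2
    ext <;> simp

end Components

end TriModule

/-! ### Direct summands of direct sums of copies of a module -/

section InAdd

variable {R : Type u} [Ring R] {C X Y : Type u} [AddCommGroup C] [Module R C]
  [AddCommGroup X] [Module R X] [AddCommGroup Y] [Module R Y]

theorem InAdd.of_retract (hY : InAdd (R := R) C Y) (i : X →ₗ[R] Y) (r : Y →ₗ[R] X)
    (h : r ∘ₗ i = LinearMap.id) : InAdd (R := R) C X := by
  obtain ⟨I, j, s, hs⟩ := hY
  refine ⟨I, j ∘ₗ i, r ∘ₗ s, LinearMap.ext fun x => ?_⟩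
  have h1 : s (j (i x)) = i x := LinearMap.congr_fun hs (i x)
  change r (s (j (i x))) = x
  rw [h1]
  exact LinearMap.congr_fun h x

theorem InAdd.of_equiv (hY : InAdd (R := R) C Y) (e : X ≃ₗ[R] Y) : InAdd (R := R) C X :=
  hY.of_retract e.toLinearMap e.symm.toLinearMap e.symm_comp

variable (R C) in
theorem inAdd_finsupp (I : Type u) : InAdd (R := R) C (I →₀ C) :=
  ⟨I, LinearMap.id, LinearMap.id, rfl⟩

theorem InAdd.projective [Module.Projective R C] (hX : InAdd (R := R) C X) :
    Module.Projective R X := by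
  obtain ⟨I, i, r, h⟩ := hX
  classical
  have : Module.Projective R (I →₀ C) := .of_equiv (finsuppLequivDFinsupp (ι := I) (M := C) R).symm
  exact Module.Projective.of_split i r h

variable (R X) in
theorem inAdd_of_projective [Module.Projective R X] : InAdd (R := R) R X := by
  obtain ⟨s, hs⟩ := Module.projective_def'.1 ‹_›
  exact ⟨X, s, _, hs⟩

end InAdd

/-! ### Exactness of `Hom` complexes -/

namespace ExactSeq

variable {R : Type u} [Ring R] {F G : Type u} [AddCommGroup F] [Module R F]
  [AddCommGroup G] [Module R G] {S : ExactSeq R}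

theorem homExact_iff : S.HomExact F ↔ ∀ (n : ℤ) (g : S.X (n + 1) →ₗ[R] F),
    g ∘ₗ S.d n = 0 → ∃ h : S.X (n + 1 + 1) →ₗ[R] F, h ∘ₗ S.d (n + 1) = g := by
  refine forall_congr' fun n => ⟨fun H g => (H g).1, fun H g => ⟨H g, ?_⟩⟩
  rintro ⟨h, rfl⟩
  ext x
  simp [(S.exact n).apply_apply_eq_zero x]

theorem HomExact.of_retract (hG : S.HomExact G) (i : F →ₗ[R] G) (r : G →ₗ[R] F)
    (h : r ∘ₗ i = LinearMap.id) : S.HomExact F := by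
  rw [homExact_iff] at hG ⊢
  intro n g hg
  obtain ⟨k, hk⟩ := hG n (i ∘ₗ g) (by rw [LinearMap.comp_assoc, hg, LinearMap.comp_zero])
  exact ⟨r ∘ₗ k, by rw [LinearMap.comp_assoc, hk, ← LinearMap.comp_assoc, h, LinearMap.id_comp]⟩

theorem homExact_congr (e : F ≃ₗ[R] G) : S.HomExact F ↔ S.HomExact G :=
  ⟨fun h => h.of_retract e.symm.toLinearMap e.toLinearMap e.comp_symm,
    fun h => h.of_retract e.toLinearMap e.symm.toLinearMap e.symm_comp⟩

theorem homExact_prod : S.HomExact (F × G) ↔ S.HomExact F ∧ S.HomExact G := by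
  refine ⟨fun h => ⟨h.of_retract (.inl R F G) (.fst R F G) (LinearMap.fst_comp_inl ..),
    h.of_retract (.inr R F G) (.snd R F G) (LinearMap.snd_comp_inr ..)⟩, fun ⟨hF, hG⟩ => ?_⟩
  rw [homExact_iff] at hF hG ⊢
  intro n g hg
  obtain ⟨k, hk⟩ := hF n (.fst R F G ∘ₗ g) (by rw [LinearMap.comp_assoc, hg, LinearMap.comp_zero])
  obtain ⟨l, hl⟩ := hG n (.snd R F G ∘ₗ g) (by rw [LinearMap.comp_assoc, hg, LinearMap.comp_zero])
  exact ⟨k.prod l, LinearMap.ext fun x =>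
    Prod.ext (LinearMap.congr_fun hk x) (LinearMap.congr_fun hl x)⟩

/-- Exactness of `Hom(S, -)` passes to direct summands, so the modules `C^(I)` suffice as test
modules. -/
theorem homAddExact_iff (C : Type u) [AddCommGroup C] [Module R C] :
    S.HomAddExact C ↔ ∀ I : Type u, S.HomExact (I →₀ C) :=
  ⟨fun h I => h (ModuleCat.of R (I →₀ C)) (inAdd_finsupp R C I),
    fun h _ ⟨I, i, r, hir⟩ => (h I).of_retract i r hir⟩

/-- The exact sequence obtained by replacing all terms by isomorphic modules. -/
@[simps]
def congr (S : ExactSeq R) (Y : ℤ → ModuleCat.{u} R) (e : ∀ n, Y n ≃ₗ[R] S.X n) :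
    ExactSeq R where
  X := Y
  d n := (e (n + 1)).symm.toLinearMap ∘ₗ S.d n ∘ₗ (e n).toLinearMap
  exact n x := by
    simp only [LinearMap.comp_apply, LinearEquiv.coe_coe, LinearEquiv.map_eq_zero_iff]
    rw [S.exact n]
    constructor
    · rintro ⟨y, hy⟩
      exact ⟨(e n).symm y, by simp [hy]⟩
    · rintro ⟨y, rfl⟩
      exact ⟨e n y, by simp⟩

theorem HomExact.congr (hS : S.HomExact F) (Y : ℤ → ModuleCat.{u} R)
    (e : ∀ n, Y n ≃ₗ[R] S.X n) : (S.congr Y e).HomExact F := by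
  rw [homExact_iff] at hS ⊢
  intro n g hg
  obtain ⟨h, hh⟩ := hS n (g ∘ₗ (e (n + 1)).symm.toLinearMap) (LinearMap.ext fun x => by
    have := LinearMap.congr_fun hg ((e n).symm x)
    change g ((e (n + 1)).symm (S.d n (e n ((e n).symm x)))) = 0 at this
    rwa [LinearEquiv.apply_symm_apply] at this)
  refine ⟨h ∘ₗ (e (n + 1 + 1)).toLinearMap, LinearMap.ext fun x => ?_⟩
  change h (e (n + 1 + 1) ((e (n + 1 + 1)).symm (S.d (n + 1) (e (n + 1) x)))) = g x
  rw [LinearEquiv.apply_symm_apply]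
  refine (LinearMap.congr_fun hh (e (n + 1) x)).trans ?_
  exact congrArg g ((e (n + 1)).symm_apply_apply x)

end ExactSeq

/-! ### The functor `p` -/

namespace TriModule

variable {A B U : Type u} [Ring A] [Ring B] [AddCommGroup U] [Module B U] [Module Aᵐᵒᵖ U]
variable {M₁ M₂ N₁ N₂ P₁ P₂ : Type u} [AddCommGroup M₁] [Module A M₁] [AddCommGroup M₂]
  [Module B M₂] [AddCommGroup N₁] [Module A N₁] [AddCommGroup N₂] [Module B N₂]
  [AddCommGroup P₁] [Module A P₁] [AddCommGroup P₂] [Module B P₂]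

theorem subsingleton_pModule [Subsingleton M₁] [Subsingleton M₂] :
    Subsingleton (pModule A B U M₁ M₂) :=
  have := BTensor.subsingleton (A := A) (B := B) (U := U) (M := M₁)
  inferInstanceAs (Subsingleton (M₁ × (BTensor A B U M₁ × M₂)))

variable [SMulCommClass B Aᵐᵒᵖ U]

/-- The map `p(f₁, f₂)`. -/
def pMap (f₁ : M₁ →ₗ[A] N₁) (f₂ : M₂ →ₗ[B] N₂) :
    pModule A B U M₁ M₂ →ₗ[TriRing A B U] pModule A B U N₁ N₂ :=
  map f₁ ((BTensor.map B U f₁).prodMap f₂) (fun z => by simp)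

theorem pMap_comp (g₁ : N₁ →ₗ[A] P₁) (g₂ : N₂ →ₗ[B] P₂) (f₁ : M₁ →ₗ[A] N₁)
    (f₂ : M₂ →ₗ[B] N₂) : pMap (g₁ ∘ₗ f₁) (g₂ ∘ₗ f₂) = pMap (U := U) g₁ g₂ ∘ₗ pMap f₁ f₂ := by
  refine LinearMap.ext fun m => ext' rfl (Prod.ext ?_ rfl)
  exact (BTensor.map_map g₁ f₁ m.2.1).symm

@[simp] theorem pMap_id : pMap (U := U) (LinearMap.id : M₁ →ₗ[A] M₁)
    (LinearMap.id : M₂ →ₗ[B] M₂) = LinearMap.id := by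
  refine LinearMap.ext fun m => ext' rfl (Prod.ext ?_ rfl)
  simp [pMap]

variable (U) in
/-- The isomorphism `p(e₁, e₂)`. -/
def pEquiv (e₁ : M₁ ≃ₗ[A] N₁) (e₂ : M₂ ≃ₗ[B] N₂) :
    pModule A B U M₁ M₂ ≃ₗ[TriRing A B U] pModule A B U N₁ N₂ :=
  LinearEquiv.ofLinearMap (pMap e₁.toLinearMap e₂.toLinearMap)
    (pMap e₁.symm.toLinearMap e₂.symm.toLinearMap)
    (by rw [← pMap_comp, LinearEquiv.comp_symm, LinearEquiv.comp_symm, pMap_id])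
    (by rw [← pMap_comp, LinearEquiv.symm_comp, LinearEquiv.symm_comp, pMap_id])

/-- The adjunction between `p` and the forgetful functor. -/
def pHom (ψ : BTensor A B U N₁ →ₗ[B] N₂) (g₁ : M₁ →ₗ[A] N₁) (g₂ : M₂ →ₗ[B] N₂) :
    pModule A B U M₁ M₂ →ₗ[TriRing A B U] TriModule ψ :=
  map g₁ ((ψ ∘ₗ BTensor.map B U g₁).coprod g₂) (fun z => by simp)

theorem pHom_comp_pMap (ψ : BTensor A B U P₁ →ₗ[B] P₂) (g₁ : N₁ →ₗ[A] P₁) (g₂ : N₂ →ₗ[B] P₂)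
    (f₁ : M₁ →ₗ[A] N₁) (f₂ : M₂ →ₗ[B] N₂) :
    pHom ψ g₁ g₂ ∘ₗ pMap f₁ f₂ = pHom ψ (g₁ ∘ₗ f₁) (g₂ ∘ₗ f₂) := by
  refine LinearMap.ext fun m => ext' rfl ?_
  change ψ (BTensor.map B U g₁ (BTensor.map B U f₁ m.2.1)) + g₂ (f₂ m.2.2) =
    ψ (BTensor.map B U (g₁ ∘ₗ f₁) m.2.1) + g₂ (f₂ m.2.2)
  rw [BTensor.map_map]

/-- On the summand `U ⊗ M₁` the second component is forced by the first one, through `ψ`. Hence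
every map out of `p(M₁, M₂)` is a `pHom`. -/
theorem pHom_eta {ψ : BTensor A B U N₁ →ₗ[B] N₂}
    (f : pModule A B U M₁ M₂ →ₗ[TriRing A B U] TriModule ψ) :
    pHom ψ (fstMap f) (sndMap f ∘ₗ .inr B _ _) = f := by
  refine hom_ext rfl (LinearMap.ext fun m => ?_)
  have h := sndMap_apply_structure f m.1
  have hm : m = (LinearMap.inl B _ M₂) m.1 + LinearMap.inr B _ M₂ m.2 := by simp
  conv_rhs => rw [hm, map_add, h]
  rfl

theorem pHom_eq_zero {ψ : BTensor A B U N₁ →ₗ[B] N₂} {g₁ : M₁ →ₗ[A] N₁} {g₂ : M₂ →ₗ[B] N₂} :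
    pHom ψ g₁ g₂ = 0 ↔ g₁ = 0 ∧ g₂ = 0 := by
  refine ⟨fun h => ⟨congrArg fstMap h, ?_⟩, ?_⟩
  · have := congrArg (fun f => sndMap f ∘ₗ .inr B _ _) h
    simpa [pHom, LinearMap.coprod_inr, sndMap_zero] using this
  · rintro ⟨rfl, rfl⟩
    refine hom_ext rfl (LinearMap.ext fun m => ?_)
    simp [pHom, sndMap_zero]

variable (A B U) in
/-- The regular module of the triangular matrix ring is `p(A, B)`. -/
def ringEquiv : TriRing A B U ≃ₗ[TriRing A B U] pModule A B U A B :=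
  LinearEquiv.ofBijective (LinearMap.toSpanSingleton _ (pModule A B U A B) (mk _ 1 (0, 1))) (by
    have key : ∀ t : TriRing A B U, t • (mk _ 1 (0, 1) : pModule A B U A B) =
        mk _ t.a (BTensor.tmul A B U t.x 1, t.b) := fun t => by
      refine ext' ?_ ?_
      · simp [fst_smul]
      · simp [snd_smul]
    constructor
    · intro s t h
      rw [LinearMap.toSpanSingleton_apply, LinearMap.toSpanSingleton_apply, key, key] at h
      -- The map `x ⊗ a ↦ x a` recovers `x` from `x ⊗ 1`.
      let l : BTensor A B U A →ₗ[B] U := BTensor.lift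
        (AddMonoidHom.mk' (fun x => AddMonoidHom.mk' (fun a : A => x <• a)
          (fun a b => by simp [add_smul]))
          (fun x y => by ext a; simp))
        (fun b x a => (smul_comm b (MulOpposite.op a) x).symm)
        (fun x a b => by simp [mul_smul])
      have hl : ∀ x, l (BTensor.tmul A B U x 1) = x := fun x => one_smul Aᵐᵒᵖ x
      have h2 := congrArg (fun m : pModule A B U A B => m.2) h
      refine TriRing.ext (congrArg (fun m : pModule A B U A B => m.1) h) ?_
        (congrArg Prod.snd h2)
      rw [← hl s.x, ← hl t.x]
      exact congrArg (fun m => l m.1) h2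
    · intro m
      have : ∀ z : BTensor A B U A, ∃ x, BTensor.tmul A B U x 1 = z := fun z => by
        induction z using BTensor.induction_on with
        | tmul x a => exact ⟨x <• a, by rw [BTensor.smul_tmul, smul_eq_mul, mul_one]⟩
        | add y z hy hz =>
          obtain ⟨x, rfl⟩ := hy
          obtain ⟨y, rfl⟩ := hz
          exact ⟨x + y, BTensor.add_tmul _ _ _⟩
      obtain ⟨x, hx⟩ := this m.2.1
      refine ⟨⟨m.1, x, m.2.2⟩, ?_⟩
      rw [LinearMap.toSpanSingleton_apply, key, hx]
      rfl)

variable (A B U M₁ M₂) in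
/-- The functor `p` commutes with direct sums. -/
def pFinsuppEquiv (I : Type u) :
    (I →₀ pModule A B U M₁ M₂) ≃ₗ[TriRing A B U] pModule A B U (I →₀ M₁) (I →₀ M₂) :=
  LinearEquiv.ofBijective
    (Finsupp.lsum ℕ fun i => pMap (U := U) (Finsupp.lsingle (R := A) i)
      (Finsupp.lsingle (R := B) i)) (by
    set f : (I →₀ pModule A B U M₁ M₂) →ₗ[TriRing A B U] pModule A B U (I →₀ M₁) (I →₀ M₂) :=
      Finsupp.lsum ℕ fun i => pMap (U := U) (Finsupp.lsingle (R := A) i)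
        (Finsupp.lsingle (R := B) i) with hf
    have hsingle : ∀ i m, f (Finsupp.single i m) = pMap (U := U) (Finsupp.lsingle (R := A) i)
      (Finsupp.lsingle (R := B) i) m := fun i m => by simp [hf]
    constructor
    -- Applying `p` to the coordinate projections recovers each coordinate, which gives injectivity.
    · have hr : ∀ i x, pMap (Finsupp.lapply i) (Finsupp.lapply i) (f x) = x i := fun i x => by
        induction x using Finsupp.induction_linear with
        | zero => simp
        | add x y hx hy => rw [map_add, map_add, hx, hy]; rfl
        | single j m =>
          rw [hsingle, ← LinearMap.comp_apply, ← pMap_comp]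
          obtain rfl | hij := eq_or_ne j i
          · rw [Finsupp.lapply_comp_lsingle_same, Finsupp.lapply_comp_lsingle_same, pMap_id]
            simp
          · rw [Finsupp.lapply_comp_lsingle_of_ne _ _ hij.symm,
              Finsupp.lapply_comp_lsingle_of_ne _ _ hij.symm, Finsupp.single_eq_of_ne hij.symm]
            exact ext' rfl (Prod.ext (by simp [pMap]) rfl)
      intro x y hxy
      ext i : 1
      rw [← hr, ← hr, hxy]
    · have h1 : ∀ m : I →₀ M₁, mk _ m 0 ∈ LinearMap.range f := fun m => by
        induction m using Finsupp.induction_linear with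
        | zero => exact zero_mem _
        | add m n hm hn => simpa [← mk_add] using add_mem hm hn
        | single i m =>
          refine ⟨Finsupp.single i (mk _ m 0), ?_⟩
          rw [hsingle]
          exact ext' rfl (map_zero _)
      have h2 : ∀ m : I →₀ M₂, mk _ 0 (0, m) ∈ LinearMap.range f := fun m => by
        induction m using Finsupp.induction_linear with
        | zero => exact zero_mem _
        | add m n hm hn => simpa [← mk_add] using add_mem hm hn
        | single i m =>
          refine ⟨Finsupp.single i (mk _ 0 (0, m)), ?_⟩
          rw [hsingle]
          exact ext' (map_zero (Finsupp.lsingle (R := A) i)) (Prod.ext (map_zero (BTensor.map B U _)) rfl)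
      -- The tensor part is generated from the vectors `(m; 0)` by strictly lower triangular
      -- matrices, so the range, being a submodule, contains it.
      have h3 : ∀ z : BTensor A B U (I →₀ M₁), mk _ 0 (z, 0) ∈ LinearMap.range f := fun z => by
        induction z using BTensor.induction_on with
        | tmul x m =>
          have := Submodule.smul_mem _ (⟨0, x, 0⟩ : TriRing A B U) (h1 m)
          convert this using 1
          exact ext' (by simp [fst_smul]) (by simp [snd_smul])
        | add y z hy hz => simpa [← mk_add] using add_mem hy hz
      intro m
      have := add_mem (add_mem (h1 m.1) (h3 m.2.1)) (h2 m.2.2)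
      rw [← mk_add, ← mk_add] at this
      have h4 : mk _ m.1 m.2 ∈ LinearMap.range f := by simpa using this
      exact h4)

/-- `p` maps `Add(C₁) × Add(C₂)` to `Add(p(C₁, C₂))`. -/
theorem inAdd_pModule (hN₁ : InAdd (R := A) M₁ N₁) (hN₂ : InAdd (R := B) M₂ N₂) :
    InAdd (R := TriRing A B U) (pModule A B U M₁ M₂) (pModule A B U N₁ N₂) := by
  obtain ⟨I, i, r, hir⟩ := hN₁
  obtain ⟨J, j, s, hjs⟩ := hN₂
  let e₁ := Finsupp.sumFinsuppLEquivProdFinsupp (α := I) (β := J) (M := M₁) A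
  let e₂ := Finsupp.sumFinsuppLEquivProdFinsupp (α := I) (β := J) (M := M₂) B
  -- The two index sets may differ; over `I ⊕ J`, `N₁` is embedded in the `I`-part and `N₂` in the
  -- `J`-part.
  refine ((inAdd_finsupp _ _ (I ⊕ J)).of_equiv (pFinsuppEquiv A B U M₁ M₂ (I ⊕ J)).symm).of_retract
    (pMap (e₁.symm.toLinearMap ∘ₗ .inl A _ _ ∘ₗ i) (e₂.symm.toLinearMap ∘ₗ .inr B _ _ ∘ₗ j))
    (pMap ((r ∘ₗ .fst A _ _) ∘ₗ e₁.toLinearMap) ((s ∘ₗ .snd B _ _) ∘ₗ e₂.toLinearMap)) ?_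
  rw [← pMap_comp]
  convert pMap_id using 2
  · ext x
    simpa using LinearMap.congr_fun hir x
  · ext x
    simpa using LinearMap.congr_fun hjs x

/-- Projectives lie in the `Add` of the regular module, `p` preserves `Add`, and `p(A, B)` is the
regular module of `T`. -/
theorem projective_pModule [Module.Projective A M₁] [Module.Projective B M₂] :
    Module.Projective (TriRing A B U) (pModule A B U M₁ M₂) :=
  have : Module.Projective (TriRing A B U) (pModule A B U A B) :=
    .of_equiv (ringEquiv A B U)
  (inAdd_pModule (inAdd_of_projective A M₁) (inAdd_of_projective B M₂)).projective

end TriModule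

/-! ### The functor `p` on exact sequences -/

section PSeq

open TriModule

variable {A B U : Type u} [Ring A] [Ring B] [AddCommGroup U] [Module B U] [Module Aᵐᵒᵖ U]
  [SMulCommClass B Aᵐᵒᵖ U]

/-- The exact sequence `p(S₁, S₂)`, for exact sequences `S₁`, `S₂` such that `U ⊗_A S₁` is
exact. -/
@[simps]
def ExactSeq.p (S₁ : ExactSeq A) (S₂ : ExactSeq B)
    (hU : ∀ n : ℤ, Function.Exact (BTensor.map B U (S₁.d n)) (BTensor.map B U (S₁.d (n + 1)))) :
    ExactSeq (TriRing A B U) where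
  X n := ModuleCat.of _ (pModule A B U (S₁.X n) (S₂.X n))
  d n := pMap (S₁.d n) (S₂.d n)
  exact n m := by
    constructor
    · intro h
      have h2 := congrArg (fun m : pModule A B U _ _ => m.2) h
      obtain ⟨x, hx⟩ := (S₁.exact n m.1).1 (congrArg (fun m : pModule A B U _ _ => m.1) h)
      obtain ⟨z, hz⟩ := (hU n m.2.1).1 (congrArg Prod.fst h2)
      obtain ⟨y, hy⟩ := (S₂.exact n m.2.2).1 (congrArg Prod.snd h2)
      exact ⟨TriModule.mk (.inl B (BTensor A B U (S₁.X n)) (S₂.X n)) x (z, y),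
        Prod.ext hx (Prod.ext hz hy)⟩
    · rintro ⟨m, rfl⟩
      exact Prod.ext ((S₁.exact n).apply_apply_eq_zero m.1)
        (Prod.ext ((hU n).apply_apply_eq_zero m.2.1) ((S₂.exact n).apply_apply_eq_zero m.2.2))

/-- By the adjunction, the `Hom` complex over `T` is the product of the two `Hom` complexes over `A`
and `B`; the structure map `ψ` plays no role in its exactness. -/
theorem ExactSeq.p_homExact_iff {S₁ : ExactSeq A} {S₂ : ExactSeq B}
    (hU : ∀ n : ℤ, Function.Exact (BTensor.map B U (S₁.d n)) (BTensor.map B U (S₁.d (n + 1))))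
    {N₁ N₂ : Type u} [AddCommGroup N₁] [Module A N₁] [AddCommGroup N₂] [Module B N₂]
    (ψ : BTensor A B U N₁ →ₗ[B] N₂) :
    (S₁.p S₂ hU).HomExact (TriModule ψ) ↔ S₁.HomExact N₁ ∧ S₂.HomExact N₂ := by
  simp only [homExact_iff]
  constructor
  · refine fun H => ⟨fun n g hg => ?_, fun n g hg => ?_⟩
    · obtain ⟨h, hh⟩ := H n (pHom ψ g 0)
        ((pHom_comp_pMap ..).trans (pHom_eq_zero.2 ⟨hg, LinearMap.zero_comp _⟩))
      refine ⟨fstMap h, ?_⟩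
      rw [← pHom_eta h] at hh
      exact congrArg fstMap hh
    · obtain ⟨h, hh⟩ := H n (pHom ψ 0 g)
        ((pHom_comp_pMap ..).trans (pHom_eq_zero.2 ⟨LinearMap.zero_comp _, hg⟩))
      refine ⟨sndMap h ∘ₗ .inr B _ _, ?_⟩
      rw [← pHom_eta h] at hh
      have := congrArg (fun f => sndMap f ∘ₗ .inr B _ _) ((pHom_comp_pMap ..).symm.trans hh)
      simpa [pHom, LinearMap.coprod_inr] using this
  · rintro ⟨H₁, H₂⟩ n g hg
    rw [← pHom_eta g] at hg ⊢
    obtain ⟨hg₁, hg₂⟩ := pHom_eq_zero.1 ((pHom_comp_pMap ..).symm.trans hg)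
    obtain ⟨h₁, hh₁⟩ := H₁ n _ hg₁
    obtain ⟨h₂, hh₂⟩ := H₂ n _ hg₂
    exact ⟨pHom ψ h₁ h₂, (pHom_comp_pMap ..).trans (by rw [hh₁, hh₂])⟩

/-- The second component of `p(C₁^(I), C₂^(I))` is `(U ⊗ C₁^(I)) ⊕ C₂^(I)`, whence two conditions on
`S₂`; the one on the tensor product is what compatibility (b) is for. -/
theorem ExactSeq.p_homExact_finsupp_iff {S₁ : ExactSeq A} {S₂ : ExactSeq B}
    (hU : ∀ n : ℤ, Function.Exact (BTensor.map B U (S₁.d n)) (BTensor.map B U (S₁.d (n + 1))))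
    (C₁ C₂ I : Type u) [AddCommGroup C₁] [Module A C₁] [AddCommGroup C₂] [Module B C₂] :
    (S₁.p S₂ hU).HomExact (I →₀ pModule A B U C₁ C₂) ↔ S₁.HomExact (I →₀ C₁) ∧
      S₂.HomExact (BTensor A B U (I →₀ C₁)) ∧ S₂.HomExact (I →₀ C₂) := by
  rw [homExact_congr (pFinsuppEquiv A B U C₁ C₂ I), p_homExact_iff, homExact_prod]

theorem ExactSeq.IsResolution.p {S₁ : ExactSeq A} {S₂ : ExactSeq B} {C₁ C₂ : Type u}
    [AddCommGroup C₁] [Module A C₁] [AddCommGroup C₂] [Module B C₂]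
    (h₁ : S₁.IsResolution C₁) (h₂ : S₂.IsResolution C₂)
    (hU : ∀ n : ℤ, Function.Exact (BTensor.map B U (S₁.d n)) (BTensor.map B U (S₁.d (n + 1)))) :
    (S₁.p S₂ hU).IsResolution (pModule A B U C₁ C₂) where
  projective n hn :=
    have := h₁.projective n hn
    have := h₂.projective n hn
    projective_pModule (M₁ := S₁.X n) (M₂ := S₂.X n)
  subsingleton n hn :=
    have := h₁.subsingleton n hn
    have := h₂.subsingleton n hn
    subsingleton_pModule (M₁ := S₁.X n) (M₂ := S₂.X n)
  equiv := ⟨pEquiv U h₁.equiv.some h₂.equiv.some⟩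

end PSeq

/-! ### Splitting of structure maps -/

namespace TriModule

section

variable {A B U : Type u} [Ring A] [Ring B] [AddCommGroup U] [Module B U] [Module Aᵐᵒᵖ U]
  [SMulCommClass B Aᵐᵒᵖ U]
variable {M₁ M₂ N₁ N₂ P₁ P₂ : Type u} [AddCommGroup M₁] [Module A M₁] [AddCommGroup M₂]
  [Module B M₂] [AddCommGroup N₁] [Module A N₁] [AddCommGroup N₂] [Module B N₂]
  [AddCommGroup P₁] [Module A P₁] [AddCommGroup P₂] [Module B P₂]
variable {φ : BTensor A B U M₁ →ₗ[B] M₂} {ψ : BTensor A B U N₁ →ₗ[B] N₂}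

variable (A B U M₁ M₂) in
/-- The cokernel of the structure map of `p(M₁, M₂)` is `M₂`. -/
def cokPEquiv : ((BTensor A B U M₁ × M₂) ⧸ LinearMap.range (LinearMap.inl B (BTensor A B U M₁) M₂))
    ≃ₗ[B] M₂ :=
  (Submodule.quotEquivOfEq _ _ (LinearMap.range_inl B (BTensor A B U M₁) M₂)).trans
    ((LinearMap.snd B (BTensor A B U M₁) M₂).quotKerEquivOfSurjective LinearMap.snd_surjective)

/-- The structure map of `p(C₁, C₂)^(I)` is the inclusion of a summand, and a splitting is inherited
by retracts: embed `M₂`, project to `U ⊗ C₁^(I)`, and return along `U ⊗ fstMap s`. -/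
theorem exists_retraction_of_inAdd {C₁ C₂ : Type u} [AddCommGroup C₁] [Module A C₁]
    [AddCommGroup C₂] [Module B C₂]
    (h : InAdd (R := TriRing A B U) (pModule A B U C₁ C₂) (TriModule φ)) :
    ∃ ρ : M₂ →ₗ[B] BTensor A B U M₁, ρ ∘ₗ φ = LinearMap.id := by
  obtain ⟨I, i, r, hir⟩ := h
  let e := pFinsuppEquiv A B U C₁ C₂ I
  let j := e.toLinearMap ∘ₗ i
  let s := r ∘ₗ e.symm.toLinearMap
  have hsj : s ∘ₗ j = LinearMap.id := by
    rw [← hir]; ext x; simp [s, j]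
  refine ⟨BTensor.map B U (fstMap s) ∘ₗ .fst B _ _ ∘ₗ sndMap j, LinearMap.ext fun z => ?_⟩
  have h1 := sndMap_apply_structure j z
  change BTensor.map B U (fstMap s) (sndMap j (φ z)).1 = z
  rw [h1]
  change BTensor.map B U (fstMap s) (BTensor.map B U (fstMap j) z) = z
  rw [BTensor.map_map, ← fstMap_comp, hsj, fstMap_id, BTensor.map_id]
  rfl

theorem inAdd_fst {C₁ C₂ : Type u} [AddCommGroup C₁] [Module A C₁]
    [AddCommGroup C₂] [Module B C₂]
    (h : InAdd (R := TriRing A B U) (pModule A B U C₁ C₂) (TriModule φ)) :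
    InAdd (R := A) C₁ M₁ := by
  obtain ⟨I, i, r, hir⟩ := h
  let e := pFinsuppEquiv A B U C₁ C₂ I
  refine ⟨I, fstMap (e.toLinearMap ∘ₗ i), fstMap (r ∘ₗ e.symm.toLinearMap), ?_⟩
  rw [← fstMap_comp, ← fstMap_id (φ := φ), ← hir]
  congr 1; ext x; simp

/-- The cokernel of the structure map is functorial, hence preserves retracts, and its value on
`p(C₁^(I), C₂^(I))` is `C₂^(I)`. -/
theorem inAdd_cok {C₁ C₂ : Type u} [AddCommGroup C₁] [Module A C₁]
    [AddCommGroup C₂] [Module B C₂]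
    (h : InAdd (R := TriRing A B U) (pModule A B U C₁ C₂) (TriModule φ)) :
    InAdd (R := B) C₂ (M₂ ⧸ LinearMap.range φ) := by
  obtain ⟨I, i, r, hir⟩ := h
  let e := pFinsuppEquiv A B U C₁ C₂ I
  refine ((inAdd_finsupp B C₂ I).of_equiv (cokPEquiv A B U (I →₀ C₁) (I →₀ C₂))).of_retract
    (cokMap (e.toLinearMap ∘ₗ i)) (cokMap (r ∘ₗ e.symm.toLinearMap)) ?_
  rw [← cokMap_comp, ← cokMap_id (φ := φ), ← hir]
  congr 1; ext x; simp

/-! ### Maps with vanishing first component -/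

variable (φ ψ) in
/-- The map `(0, g)` induced by a map `g` from the cokernel of the structure map. -/
def ofCok (g : (M₂ ⧸ LinearMap.range φ) →ₗ[B] N₂) : TriModule φ →ₗ[TriRing A B U] TriModule ψ :=
  map 0 (g ∘ₗ Submodule.mkQ _) (fun z => by
    have : (LinearMap.range φ).mkQ (φ z) = 0 := (Submodule.Quotient.mk_eq_zero _).2 ⟨z, rfl⟩
    simp [this])

theorem ofCok_comp (g : (N₂ ⧸ LinearMap.range ψ) →ₗ[B] P₂) (χ : BTensor A B U P₁ →ₗ[B] P₂)
    (f : TriModule φ →ₗ[TriRing A B U] TriModule ψ) :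
    ofCok ψ χ g ∘ₗ f = ofCok φ χ (g ∘ₗ cokMap f) := by
  refine hom_ext ?_ ?_
  · rw [fstMap_comp]
    exact LinearMap.zero_comp _
  · rw [sndMap_comp]
    rfl

theorem ofCok_injective : Function.Injective (ofCok φ ψ) := fun _ _ hgh =>
  Submodule.linearMap_qext _ (congrArg sndMap hgh)

theorem exists_eq_ofCok (f : TriModule φ →ₗ[TriRing A B U] TriModule ψ) (hf : fstMap f = 0) :
    ∃ g, f = ofCok φ ψ g := by
  refine ⟨(LinearMap.range φ).liftQ (sndMap f) ?_, hom_ext hf rfl⟩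
  rintro _ ⟨z, rfl⟩
  rw [LinearMap.mem_ker, sndMap_apply_structure, hf, BTensor.map_zero, LinearMap.zero_apply,
    map_zero]

end

/-! ### The components of an exact sequence -/

section Sequences

variable {A B U : Type u} [Ring A] [Ring B] [AddCommGroup U] [Module B U] [Module Aᵐᵒᵖ U]
  [SMulCommClass B Aᵐᵒᵖ U]
variable {M₁ : ℤ → ModuleCat.{u} A} {M₂ : ℤ → ModuleCat.{u} B}
  {φ : ∀ n, BTensor A B U (M₁ n) →ₗ[B] M₂ n}
  {D : ∀ n, TriModule (φ n) →ₗ[TriRing A B U] TriModule (φ (n + 1))}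

theorem fstMap_exact (hD : ∀ n, Function.Exact (D n) (D (n + 1))) (n : ℤ) :
    Function.Exact (fstMap (D n)) (fstMap (D (n + 1))) := fun x => by
  constructor
  · intro hx
    obtain ⟨y, hy⟩ := (hD n (mk _ x 0)).1 (by
      rw [apply_eq, mk_fst, mk_snd, hx, map_zero]; rfl)
    exact ⟨y.1, by rw [← apply_fst, hy, mk_fst]⟩
  · rintro ⟨y, rfl⟩
    have h := (hD n).apply_apply_eq_zero (mk _ y 0)
    have h' := congrArg (fun m : TriModule _ => m.1) h
    rwa [apply_fst, apply_fst] at h'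

theorem sndMap_exact (hD : ∀ n, Function.Exact (D n) (D (n + 1))) (n : ℤ) :
    Function.Exact (sndMap (D n)) (sndMap (D (n + 1))) := fun x => by
  constructor
  · intro hx
    obtain ⟨y, hy⟩ := (hD n (mk _ 0 x)).1 (by
      rw [apply_eq, mk_fst, mk_snd, hx, map_zero]; rfl)
    exact ⟨y.2, by rw [← apply_snd, hy, mk_snd]⟩
  · rintro ⟨y, rfl⟩
    have h := (hD n).apply_apply_eq_zero (mk _ 0 y)
    have h' := congrArg (fun m : TriModule _ => m.2) h
    rwa [apply_snd, apply_snd] at h'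

/-- With injective structure maps, `0 → U ⊗ M₁ → M₂ → coker φ → 0` is a short exact sequence of
complexes; the first two are exact, hence so is the third. -/
theorem cokMap_exact (hD : ∀ n, Function.Exact (D n) (D (n + 1)))
    (hφ : ∀ n, Function.Injective (φ n))
    (hU : ∀ n, Function.Exact (BTensor.map B U (fstMap (D n)))
      (BTensor.map B U (fstMap (D (n + 1))))) (n : ℤ) :
    Function.Exact (cokMap (D n)) (cokMap (D (n + 1))) := fun x => by
  obtain ⟨x, rfl⟩ := Submodule.Quotient.mk_surjective _ x
  constructor
  · intro hx
    obtain ⟨z, hz⟩ := (Submodule.Quotient.mk_eq_zero _).1 hx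
    -- By injectivity of the next structure map, `z` is a cycle of `U ⊗ M₁`, hence a boundary of
    -- some `w`; subtracting `φ w` from `x` leaves a cycle of `M₂`.
    obtain ⟨w, rfl⟩ := (hU (n + 1) z).1 (hφ _ (by
      rw [← sndMap_apply_structure, hz, (sndMap_exact hD (n + 1)).apply_apply_eq_zero, map_zero]))
    obtain ⟨y, hy⟩ := (sndMap_exact hD n (x - φ _ w)).1 (by
      rw [map_sub, sndMap_apply_structure, hz, sub_self])
    refine ⟨Submodule.Quotient.mk y, ?_⟩
    rw [cokMap_mk, hy, Submodule.Quotient.eq]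
    exact ⟨-w, by rw [map_neg]; abel⟩
  · rintro ⟨y, hy⟩
    obtain ⟨y, rfl⟩ := Submodule.Quotient.mk_surjective _ y
    rw [← hy, cokMap_mk, cokMap_mk, (sndMap_exact hD n).apply_apply_eq_zero]
    rfl

/-- Exactness of `Hom` into `(0, N₂)` passes to the cokernels of the structure maps. -/
theorem cok_homExact {N₁ N₂ : Type u} [AddCommGroup N₁] [Module A N₁] [Subsingleton N₁]
    [AddCommGroup N₂] [Module B N₂] (ψ : BTensor A B U N₁ →ₗ[B] N₂)
    (hD : ∀ n, Function.Exact (D n) (D (n + 1)))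
    (hcok : ∀ n, Function.Exact (cokMap (D n)) (cokMap (D (n + 1))))
    (h : ExactSeq.HomExact ⟨fun n => ModuleCat.of _ (TriModule (φ n)), D, hD⟩ (TriModule ψ)) :
    ExactSeq.HomExact ⟨fun n => ModuleCat.of B (M₂ n ⧸ LinearMap.range (φ n)),
      fun n => cokMap (D n), hcok⟩ N₂ := by
  rw [ExactSeq.homExact_iff] at h ⊢
  intro n g hg
  obtain ⟨H, hH⟩ := h n (ofCok _ ψ g) ((ofCok_comp g ψ (D n)).trans (congrArg (ofCok _ ψ) hg))
  -- Since `N₁` is zero, the extension `H` has zero first component and factors through the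
  -- cokernel.
  obtain ⟨k, rfl⟩ := exists_eq_ofCok H (LinearMap.ext fun _ => Subsingleton.elim _ _)
  exact ⟨k, ofCok_injective ((ofCok_comp k ψ (D (n + 1))).symm.trans hH)⟩

/-- Exactness of `Hom` into `p(N₁, 0) = (N₁, U ⊗_A N₁)` and of `Hom` from the cokernels into
`U ⊗_A N₁` gives exactness of `Hom` from the first components into `N₁`. -/
theorem fst_homExact {N₁ : Type u} [AddCommGroup N₁] [Module A N₁]
    (hD : ∀ n, Function.Exact (D n) (D (n + 1)))
    (hcok : ∀ n, Function.Exact (cokMap (D n)) (cokMap (D (n + 1))))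
    (hρ : ∀ n, ∃ ρ : M₂ n →ₗ[B] BTensor A B U (M₁ n), ρ ∘ₗ φ n = LinearMap.id)
    (h : ExactSeq.HomExact ⟨fun n => ModuleCat.of _ (TriModule (φ n)), D, hD⟩
      (TriModule (LinearMap.id : BTensor A B U N₁ →ₗ[B] _)))
    (hc : ExactSeq.HomExact ⟨fun n => ModuleCat.of B (M₂ n ⧸ LinearMap.range (φ n)),
      fun n => cokMap (D n), hcok⟩ (BTensor A B U N₁)) :
    ExactSeq.HomExact ⟨M₁, fun n => fstMap (D n), fstMap_exact hD⟩ N₁ := by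
  rw [ExactSeq.homExact_iff] at h hc ⊢
  intro n g hg
  -- The obstruction `k` below lives one degree before `g`, and its cocycle condition involves the
  -- degree before that.
  obtain ⟨m, rfl⟩ : ∃ m, n = m + 1 := ⟨n - 1, (sub_add_cancel n 1).symm⟩
  obtain ⟨ρ, hρ⟩ := hρ (m + 1 + 1)
  let ψ : BTensor A B U N₁ →ₗ[B] BTensor A B U N₁ := LinearMap.id
  -- The retraction `ρ` extends `g` to a `T`-linear map `G`. Its composite with `D` need not vanish,
  -- but has zero first component, hence is given by a map `k` on the cokernel.
  let G : TriModule (φ (m + 1 + 1)) →ₗ[TriRing A B U] TriModule ψ :=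
    map g (BTensor.map B U g ∘ₗ ρ) (fun z => congrArg (BTensor.map B U g) (LinearMap.congr_fun hρ z))
  obtain ⟨k, hk⟩ := exists_eq_ofCok (G ∘ₗ D (m + 1)) ((fstMap_comp _ _).trans hg)
  -- The map `k` is a cocycle, so it extends to `l` by exactness of `Hom` into `U ⊗ N₁`. Subtracting
  -- `l` from `G` gives a cocycle with the same first component `g`.
  obtain ⟨l, hl⟩ := hc m k (ofCok_injective (ψ := ψ) (by
    refine (ofCok_comp k ψ (D m)).symm.trans ?_
    rw [← hk, LinearMap.comp_assoc, (hD m).linearMap_comp_eq_zero, LinearMap.comp_zero]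
    rfl))
  obtain ⟨H, hH⟩ := h (m + 1) (G - ofCok _ ψ l) (by
    refine (LinearMap.sub_comp _ _ _).trans ?_
    rw [sub_eq_zero]
    exact hk.trans ((congrArg (ofCok _ ψ) hl.symm).trans (ofCok_comp l ψ (D (m + 1))).symm))
  refine ⟨fstMap H, (fstMap_comp H (D (m + 1 + 1))).symm.trans ((congrArg fstMap hH).trans ?_)⟩
  exact LinearMap.ext fun x => sub_zero (g x)

end Sequences

end TriModule

/-! ### w-tilting modules over the triangular matrix ring -/

section Main

open TriModule CategoryTheory.Abelian

section

variable {R : Type u} [Ring R]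

theorem inAdd_self (C : Type u) [AddCommGroup C] [Module R C] : InAdd (R := R) C C :=
  (inAdd_finsupp R C PUnit).of_equiv (Finsupp.uniqueLinearEquiv R C PUnit.unit).symm

theorem inAdd_of_subsingleton (C X : Type u) [AddCommGroup C] [Module R C] [AddCommGroup X]
    [Module R X] [Subsingleton X] : InAdd (R := R) C X :=
  (inAdd_self C).of_retract 0 0 (LinearMap.ext fun _ => Subsingleton.elim _ _)

/-- With `C⁰ = C` and zero terms afterwards, a resolution is a sequence to which compatibility
applies. -/
theorem ExactSeq.IsResolution.isProjAdd {S : ExactSeq R} {C : Type u} [AddCommGroup C]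
    [Module R C] (hS : S.IsResolution C) : S.IsProjAdd C := by
  refine ⟨hS.projective, fun n hn => ?_⟩
  obtain rfl | hn := hn.eq_or_lt
  · exact (inAdd_self C).of_equiv hS.equiv.some
  · have := hS.subsingleton n hn
    exact inAdd_of_subsingleton C (S.X n)

theorem ExactSeq.IsResolution.homAddExact_iff {S : ExactSeq R} {C : Type u} [AddCommGroup C]
    [Module R C] (hS : S.IsResolution C) : S.HomAddExact C ↔ ∀ (I : Type u) (i : ℕ), 1 ≤ i →
      Subsingleton (Ext (ModuleCat.of R C) (ModuleCat.of R (I →₀ C)) i) := by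
  rw [ExactSeq.homAddExact_iff]
  exact forall_congr' fun I => (hS.ext_iff (I →₀ C)).symm

theorem ExactSeq.isProjAdd_of_coresolution {S : ExactSeq R} {C : Type u} [AddCommGroup C]
    [Module R C] (h : ∀ n : ℤ, n < -1 → Subsingleton (S.X n)) (h' : Nonempty (S.X (-1) ≃ₗ[R] R))
    (hC : ∀ n : ℤ, 0 ≤ n → InAdd (R := R) C (S.X n)) : S.IsProjAdd C := by
  refine ⟨fun n hn => ?_, hC⟩
  obtain hn | rfl : n < -1 ∨ n = -1 := by omega
  · have := h n hn
    infer_instance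
  · exact .of_equiv h'.some.symm

end

variable {A B U : Type u} [Ring A] [Ring B] [AddCommGroup U]
    [Module B U] [Module Aᵐᵒᵖ U] [SMulCommClass B Aᵐᵒᵖ U]
    {C₁ C₂ : Type u} [AddCommGroup C₁] [Module A C₁] [AddCommGroup C₂] [Module B C₂]

theorem ExactSeq.p_homAddExact_iff (hU : IsCompatible A B U C₁ C₂) {S₁ : ExactSeq A}
    {S₂ : ExactSeq B} (h₁ : S₁.IsProjAdd C₁) (h₂ : S₂.IsProjAdd C₂) :
    (S₁.p S₂ (hU.1 S₁ h₁)).HomAddExact (pModule A B U C₁ C₂) ↔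
      S₁.HomAddExact C₁ ∧ S₂.HomAddExact C₂ := by
  rw [ExactSeq.homAddExact_iff]
  simp_rw [p_homExact_finsupp_iff]
  constructor
  · exact fun h => ⟨(ExactSeq.homAddExact_iff _).2 fun I => (h I).1,
      (ExactSeq.homAddExact_iff _).2 fun I => (h I).2.2⟩
  · rintro ⟨H₁, H₂⟩ I
    -- Compatibility (b) enters here and yields the condition on `U ⊗ C₁^(I)`.
    exact ⟨(ExactSeq.homAddExact_iff _).1 H₁ I,
      hU.2 S₂ h₂ H₂ (ModuleCat.of A (I →₀ C₁)) (inAdd_finsupp A C₁ I),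
      (ExactSeq.homAddExact_iff _).1 H₂ I⟩

theorem pModule_ext_vanishing_iff (hU : IsCompatible A B U C₁ C₂) :
    (∀ (I : Type u) (i : ℕ), 1 ≤ i → Subsingleton
      (Ext (ModuleCat.of (TriRing A B U) (pModule A B U C₁ C₂))
        (ModuleCat.of (TriRing A B U) (I →₀ pModule A B U C₁ C₂)) i)) ↔
    (∀ (I : Type u) (i : ℕ), 1 ≤ i →
      Subsingleton (Ext (ModuleCat.of A C₁) (ModuleCat.of A (I →₀ C₁)) i)) ∧
    (∀ (I : Type u) (i : ℕ), 1 ≤ i →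
      Subsingleton (Ext (ModuleCat.of B C₂) (ModuleCat.of B (I →₀ C₂)) i)) := by
  obtain ⟨S₁, h₁⟩ := exists_isResolution (R := A) C₁
  obtain ⟨S₂, h₂⟩ := exists_isResolution (R := B) C₂
  rw [← h₁.homAddExact_iff, ← h₂.homAddExact_iff,
    ← (h₁.p h₂ (hU.1 S₁ h₁.isProjAdd)).homAddExact_iff,
    ExactSeq.p_homAddExact_iff hU h₁.isProjAdd h₂.isProjAdd]

theorem IsWTilting.pModule (hU : IsCompatible A B U C₁ C₂) (hC₁ : IsWTilting A C₁)
    (hC₂ : IsWTilting B C₂) : IsWTilting (TriRing A B U) (pModule A B U C₁ C₂) := by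
  refine ⟨(pModule_ext_vanishing_iff hU).2 ⟨hC₁.1, hC₂.1⟩, ?_⟩
  obtain ⟨-, S₁, hs₁, ⟨e₁⟩, ha₁, hh₁⟩ := hC₁
  obtain ⟨-, S₂, hs₂, ⟨e₂⟩, ha₂, hh₂⟩ := hC₂
  have h₁ := ExactSeq.isProjAdd_of_coresolution hs₁ ⟨e₁⟩ ha₁
  have h₂ := ExactSeq.isProjAdd_of_coresolution hs₂ ⟨e₂⟩ ha₂
  refine ⟨S₁.p S₂ (hU.1 S₁ h₁), fun n hn => ?_, ⟨(pEquiv U e₁ e₂).trans (ringEquiv A B U).symm⟩,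
    fun n hn => inAdd_pModule (ha₁ n hn) (ha₂ n hn),
    (ExactSeq.p_homAddExact_iff hU h₁ h₂).2 ⟨hh₁, hh₂⟩⟩
  have := hs₁ n hn
  have := hs₂ n hn
  exact subsingleton_pModule (M₁ := S₁.X n) (M₂ := S₂.X n)

variable (A B U C₁ C₂) in
-- This module is `p(0, C₂^(I))`, up to isomorphism, a summand of `p(C₁^(I), C₂^(I))`; it is the
-- test module for the cokernel sequence.
theorem inAdd_zero_finsupp (I : Type u) : InAdd (R := TriRing A B U) (pModule A B U C₁ C₂)
    (TriModule (0 : BTensor A B U PUnit.{u + 1} →ₗ[B] (I →₀ C₂))) :=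
  ((inAdd_finsupp _ _ I).of_equiv (pFinsuppEquiv A B U C₁ C₂ I).symm).of_retract
    (map 0 (.inr B _ _) (fun z => by simp)) (map 0 (.snd B _ _) (fun z => by simp))
    (hom_ext (LinearMap.ext fun _ => rfl) rfl)

variable (A B U C₁ C₂) in
-- The complementary summand `p(C₁^(I), 0)`, the test module for the sequence of first components.
theorem inAdd_finsupp_tensor (I : Type u) : InAdd (R := TriRing A B U) (pModule A B U C₁ C₂)
    (TriModule (LinearMap.id : BTensor A B U (I →₀ C₁) →ₗ[B] _)) :=
  ((inAdd_finsupp _ _ I).of_equiv (pFinsuppEquiv A B U C₁ C₂ I).symm).of_retract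
    (map .id (.inl B _ _) (fun z => by simp)) (map .id (.fst B _ _) (fun z => by simp))
    (hom_ext rfl rfl)

theorem isWTilting_of_pModule (hU : IsCompatible A B U C₁ C₂)
    (hC : IsWTilting (TriRing A B U) (pModule A B U C₁ C₂)) :
    IsWTilting A C₁ ∧ IsWTilting B C₂ := by
  obtain ⟨hE₁, hE₂⟩ := (pModule_ext_vanishing_iff hU).1 hC.1
  obtain ⟨-, S, hs, ⟨e⟩, ha, hh⟩ := hC
  let M₁ : ℤ → ModuleCat.{u} A := fun n => ModuleCat.of A (Fst A B U (S.X n))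
  let M₂ : ℤ → ModuleCat.{u} B := fun n => ModuleCat.of B (Snd A B U (S.X n))
  let φ : ∀ n, BTensor A B U (M₁ n) →ₗ[B] M₂ n := fun n => structureMap A B U (S.X n)
  let eq : ∀ n, TriModule (φ n) ≃ₗ[TriRing A B U] S.X n := fun n => equivComponents A B U (S.X n)
  let S' := S.congr (fun n => ModuleCat.of _ (TriModule (φ n))) eq
  let D : ∀ n, TriModule (φ n) →ₗ[TriRing A B U] TriModule (φ (n + 1)) := S'.d
  have hD : ∀ n, Function.Exact (D n) (D (n + 1)) := S'.exact
  have hSF : ∀ (F : Type u) [AddCommGroup F] [Module (TriRing A B U) F],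
      InAdd (R := TriRing A B U) (pModule A B U C₁ C₂) F → S'.HomExact F :=
    fun F _ _ hF => (hh (ModuleCat.of _ F) hF).congr _ _
  let E : TriModule (φ (-1)) ≃ₗ[TriRing A B U] pModule A B U A B :=
    ((eq (-1)).trans e).trans (ringEquiv A B U)
  have hadd : ∀ n : ℤ, 0 ≤ n →
      InAdd (R := TriRing A B U) (pModule A B U C₁ C₂) (TriModule (φ n)) :=
    fun n hn => (ha n hn).of_equiv (eq n)
  -- The terms lie in `Add` of `p(C₁, C₂)`, zero terms included, except in degree `-1`, where the
  -- term is `p(A, B)` and the splitting lemma is used with `(A, B)` in place of `(C₁, C₂)`.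
  have hρ : ∀ n, ∃ ρ : M₂ n →ₗ[B] BTensor A B U (M₁ n), ρ ∘ₗ φ n = LinearMap.id := by
    intro n
    obtain hn | rfl | hn : n < -1 ∨ n = -1 ∨ 0 ≤ n := by omega
    · have := hs n hn
      have : Subsingleton (TriModule (φ n)) := (eq n).toEquiv.subsingleton
      exact exists_retraction_of_inAdd
        (inAdd_of_subsingleton (pModule A B U C₁ C₂) (TriModule (φ n)))
    · exact exists_retraction_of_inAdd ((inAdd_self (pModule A B U A B)).of_equiv E)
    · exact exists_retraction_of_inAdd (hadd n hn)
  have hφ : ∀ n, Function.Injective (φ n) := fun n =>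
    Function.LeftInverse.injective (LinearMap.congr_fun (hρ n).choose_spec)
  let S₁ : ExactSeq A := ⟨M₁, fun n => fstMap (D n), fstMap_exact hD⟩
  have hs₁ : ∀ n : ℤ, n < -1 → Subsingleton (S₁.X n) := fun n hn =>
    have := hs n hn
    inferInstanceAs (Subsingleton (Fst A B U (S.X n)))
  have he₁ : Nonempty (S₁.X (-1) ≃ₗ[A] A) := ⟨fstEquiv E⟩
  have ha₁ : ∀ n : ℤ, 0 ≤ n → InAdd (R := A) C₁ (S₁.X n) := fun n hn => inAdd_fst (hadd n hn)
  -- Compatibility (a) applies with `A` in degree `-1` as the only possibly nonzero projective; it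
  -- makes the cokernel sequence exact.
  have hUS₁ := hU.1 S₁ (ExactSeq.isProjAdd_of_coresolution hs₁ he₁ ha₁)
  let S₂ : ExactSeq B := ⟨fun n => ModuleCat.of B (M₂ n ⧸ LinearMap.range (φ n)),
    fun n => cokMap (D n), cokMap_exact hD hφ hUS₁⟩
  have hs₂ : ∀ n : ℤ, n < -1 → Subsingleton (S₂.X n) := fun n hn =>
    have := hs n hn
    (Submodule.Quotient.mk_surjective (LinearMap.range (structureMap A B U (S.X n)))).subsingleton
  have he₂ : Nonempty (S₂.X (-1) ≃ₗ[B] B) := ⟨(cokEquiv E).trans (cokPEquiv A B U A B)⟩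
  have ha₂ : ∀ n : ℤ, 0 ≤ n → InAdd (R := B) C₂ (S₂.X n) := fun n hn => inAdd_cok (hadd n hn)
  -- The cokernels come before the first components: (b) can be applied to `S₂` only once `S₂` is
  -- `Hom(-, Add(C₂))`-exact.
  have hh₂ : S₂.HomAddExact C₂ := (ExactSeq.homAddExact_iff C₂).2 fun I =>
    cok_homExact _ hD _ (hSF _ (inAdd_zero_finsupp A B U C₁ C₂ I))
  have hh₁ : S₁.HomAddExact C₁ := (ExactSeq.homAddExact_iff C₁).2 fun I =>
    fst_homExact hD _ hρ (hSF _ (inAdd_finsupp_tensor A B U C₁ C₂ I))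
      (hU.2 S₂ (ExactSeq.isProjAdd_of_coresolution hs₂ he₂ ha₂) hh₂
        (ModuleCat.of A (I →₀ C₁)) (inAdd_finsupp A C₁ I))
  exact ⟨⟨hE₁, S₁, hs₁, he₁, ha₁, hh₁⟩, ⟨hE₂, S₂, hs₂, he₂, ha₂, hh₂⟩⟩

end Main
end

theorem mainTheorem6 (A B U : Type u) [Ring A] [Ring B] [AddCommGroup U]
    [Module B U] [Module Aᵐᵒᵖ U] [SMulCommClass B Aᵐᵒᵖ U]
    (C₁ C₂ : Type u) [AddCommGroup C₁] [Module A C₁] [AddCommGroup C₂] [Module B C₂]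
    (hU : IsCompatible A B U C₁ C₂) :
    IsWTilting (TriRing A B U) (pModule A B U C₁ C₂) ↔ IsWTilting A C₁ ∧ IsWTilting B C₂ :=
  ⟨isWTilting_of_pModule hU, fun h => h.1.pModule hU h.2⟩
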